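/- Let $N\ge 2$, let $B=\{y\in\mathbb{R}^N:|y|<1\}$ and let $\Omega\subset\mathbb{R}^N$ be an open set of finite Lebesgue measure. Let $y^p\in\mathbb{R}^N$ and $\varepsilon_p>0$ ($p\in\mathbb{N}$) be such that the balls $\varepsilon_pB+y^p$ are pairwise disjoint and $\Omega$ coincides with $\bigcup_{p\in\mathbb{N}}(\varepsilon_pB+y^p)$ up to a Lebesgue null set; assume that $\Omega$ is not contained in the union $\bigcup_{p\in\mathbb{N}}(\varepsilon_pB+y^p)$ of these open balls (this is automatic if $\Omega$ is connected). Let $f\in H^1(B)$ be real- or complex-valued, and let $F$ be the function defined almost everywhere on $\Omega$ by $$F(x)=\varepsilon_p\,f\Big(\frac{x-y^p}{\varepsilon_p}\Big)\qquad\text{for a.e. } x\in\varepsilon_pB+y^p,\ p\in\mathbb{N}.$$ Then $F\in H^1(\Omega)$ if and only if the trace of $f$ on $\partial B$ vanishes. Moreover, the trace of $f$ on $\partial B$ vanishes if and only if $f\in H^1_0(B)$, so that $F\in H^1(\Omega)$ if and only if $f\in H^1_0(B)$. Here $H^1_0(B)$ is the closure of $C_c^\infty(B)$ in $H^1(B)$,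 and the trace operator $H^1(B)\to L^2(\partial B)$ is the closure of the restriction map $u\mapsto u|_{\partial B}$, $u\in C^1(\overline B)$. -/

import Mathlib

open MeasureTheory Filter Set Metric Topology
open scoped ContDiff

/-- `φ` is a test function on the open set `U`: smooth, with compact support contained in `U`. -/
def IsTestFunction {N : ℕ} {𝕜 : Type*} [RCLike 𝕜] (U : Set (EuclideanSpace ℝ (Fin N)))
    (φ : EuclideanSpace ℝ (Fin N) → 𝕜) : Prop :=
  ContDiff ℝ ∞ φ ∧ HasCompactSupport φ ∧ tsupport φ ⊆ U

/-- The classical `i`-th partial derivative of a (differentiable) function on `ℝ^N`. -/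
noncomputable def partialDeriv {N : ℕ} {𝕜 : Type*} [RCLike 𝕜] (i : Fin N)
    (u : EuclideanSpace ℝ (Fin N) → 𝕜) (x : EuclideanSpace ℝ (Fin N)) : 𝕜 :=
  fderiv ℝ u x (EuclideanSpace.single i 1)

/-- `f ∈ L²(U)` and its weak partial derivatives on `U` are the functions `G i ∈ L²(U)`. -/
structure HasH1Gradient {N : ℕ} {𝕜 : Type*} [RCLike 𝕜] (U : Set (EuclideanSpace ℝ (Fin N)))
    (f : EuclideanSpace ℝ (Fin N) → 𝕜) (G : Fin N → EuclideanSpace ℝ (Fin N) → 𝕜) : Prop where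
  memLp : MemLp f 2 (volume.restrict U)
  memLp_grad : ∀ i, MemLp (G i) 2 (volume.restrict U)
  integral_eq : ∀ i, ∀ φ : EuclideanSpace ℝ (Fin N) → ℝ, IsTestFunction U φ →
    ∫ x in U, partialDeriv i φ x • f x = - ∫ x in U, φ x • G i x

/-- `f ∈ H¹(U)` (only the values of `f` almost everywhere on `U` matter). -/
def MemH1 {N : ℕ} {𝕜 : Type*} [RCLike 𝕜] (U : Set (EuclideanSpace ℝ (Fin N)))
    (f : EuclideanSpace ℝ (Fin N) → 𝕜) : Prop :=
  ∃ G : Fin N → EuclideanSpace ℝ (Fin N) → 𝕜, HasH1Gradient U f G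

/-- `f ∈ H¹(U)` and the sequence `u n` of continuously differentiable functions converges
to `f` in the norm of `H¹(U)`. -/
def TendstoH1 {N : ℕ} {𝕜 : Type*} [RCLike 𝕜] (U : Set (EuclideanSpace ℝ (Fin N)))
    (u : ℕ → EuclideanSpace ℝ (Fin N) → 𝕜) (f : EuclideanSpace ℝ (Fin N) → 𝕜) : Prop :=
  ∃ G : Fin N → EuclideanSpace ℝ (Fin N) → 𝕜, HasH1Gradient U f G ∧
    Tendsto (fun n => eLpNorm (fun x => u n x - f x) 2 (volume.restrict U)) atTop (𝓝 0) ∧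
    ∀ i, Tendsto (fun n => eLpNorm (fun x => partialDeriv i (u n) x - G i x) 2
      (volume.restrict U)) atTop (𝓝 0)

/-- `f ∈ H¹₀(U)`, the closure of the test functions on `U` in `H¹(U)`. -/
def MemH10 {N : ℕ} {𝕜 : Type*} [RCLike 𝕜] (U : Set (EuclideanSpace ℝ (Fin N)))
    (f : EuclideanSpace ℝ (Fin N) → 𝕜) : Prop :=
  ∃ u : ℕ → EuclideanSpace ℝ (Fin N) → 𝕜, (∀ n, IsTestFunction U (u n)) ∧ TendstoH1 U u f

/-- `g ∈ L²(∂B)` is the trace on `∂B` of `f ∈ H¹(B)`, where `B` is the open unit ball: the trace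
operator is the closure, as a map from `H¹(B)` to `L²(∂B)`, of the restriction
`u ↦ u|_{∂B}` of functions that are continuously differentiable up to the boundary.
The measure `volume.toSphere` is the surface measure of the unit sphere. -/
def HasTrace {N : ℕ} {𝕜 : Type*} [RCLike 𝕜] (f : EuclideanSpace ℝ (Fin N) → 𝕜)
    (g : sphere (0 : EuclideanSpace ℝ (Fin N)) 1 → 𝕜) : Prop :=
  MemLp g 2 (volume : Measure (EuclideanSpace ℝ (Fin N))).toSphere ∧
    ∃ u : ℕ → EuclideanSpace ℝ (Fin N) → 𝕜, (∀ n, ContDiff ℝ 1 (u n)) ∧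
      TendstoH1 (ball 0 1) u f ∧
      Tendsto (fun n => eLpNorm (fun z : sphere (0 : EuclideanSpace ℝ (Fin N)) 1 => u n z - g z) 2
        (volume : Measure (EuclideanSpace ℝ (Fin N))).toSphere) atTop (𝓝 0)

/-! Let G be a weak gradient of f on B. Green's formula suggests that ∫_B (∂_iψ f + ψ G_i) equals
∫_{∂B} ψ ν_i tr f. The left side, `boundaryFunctional`, needs no trace, and every condition in the
theorem is compared with its vanishing for all i and all ψ ∈ C_c^∞(ℝ^N).

On the unit ball: if the functional vanishes, then f extended by zero has G extended by zero as weak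
gradient, so dilating by a factor slightly above 1 and mollifying yields test functions on B
converging to f, that is, f ∈ H¹₀(B) (`HasH1Gradient.memH10_of_integral_eq`). Functions in H¹₀(B)
clearly have zero trace. If the trace is zero, Green's formula for C¹ approximations, passed to the
limit, shows that the functional vanishes.

On Ω: the factor ε_p makes gradients scale-free, so pairing F and its candidate gradient with a test
function φ gives ∑_q ε_q^N b(φ(ε_q · + y^q)), where b is the functional of f
(`IsTestFunction.hasSum_boundaryFunctional`). If b = 0, the rescaled gradients glue to a weak
gradient of F; they are square integrable because ∑ ε_q^N is finite.

Conversely, if F ∈ H¹(Ω), this series vanishes for every test function on Ω, and a single term has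
to be isolated. Some closed ball lies in Ω: near a point of Ω outside all the open balls infinitely
many balls accumulate, and their radii tend to 0 (`exists_closedBall_subset`). Let φ_n be ψ
transplanted to that ball and cut off in shrinking neighbourhoods of it. The term of that ball is
always b(ψ). The others tend to 0, since |b(η)| ≤ M ‖η‖ in L²(∂B) (trace inequality and density of
smooth functions), and a sphere around another ball meets the closed ball in at most one point,
which is null because N ≥ 2. Dominated convergence for series gives b(ψ) = 0
(`boundaryFunctional_eq_zero_of_tsum_eq_zero`). -/

/-! ### Polar coordinates and the radial divergence theorem -/

section Polar

variable {E V : Type*} [NormedAddCommGroup E] [NormedSpace ℝ E] [MeasurableSpace E] [BorelSpace E]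
  [FiniteDimensional ℝ E] [Nontrivial E] [NormedAddCommGroup V] [NormedSpace ℝ V]
  (μ : Measure E) [μ.IsAddHaarMeasure]

/-- Integration over the unit ball in polar coordinates. -/
theorem integral_ball_eq_integral_toSphere {k : E → V} (hk : Continuous k) :
    ∫ x in ball 0 1, k x ∂μ =
      ∫ z, (∫ r in (0 : ℝ)..1, r ^ (Module.finrank ℝ E - 1) • k (r • (z : E))) ∂μ.toSphere := by
  set n := Module.finrank ℝ E - 1
  have hmp := μ.measurePreserving_homeomorphUnitSphereProd
  have hemb := (homeomorphUnitSphereProd E).measurableEmbedding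
  set h : E → V := (ball (0 : E) 1).indicator k
  set H : sphere (0 : E) 1 × Ioi (0 : ℝ) → V := fun p => h ((p.2 : ℝ) • (p.1 : E))
  have hH : ∀ x : ({0}ᶜ : Set E), H (homeomorphUnitSphereProd E x) = h x := fun x => by
    have := congrArg Subtype.val ((homeomorphUnitSphereProd E).symm_apply_apply x)
    rw [homeomorphUnitSphereProd_symm_apply_coe] at this
    simp only [H, this]
  have hint : Integrable h μ := by
    rw [integrable_indicator_iff measurableSet_ball]
    exact (hk.continuousOn.integrableOn_compact (isCompact_closedBall 0 1)).mono_set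
      ball_subset_closedBall
  have hHint : Integrable H (μ.toSphere.prod (.volumeIoiPow n)) := by
    rw [← hmp.integrable_comp_emb hemb]
    refine Integrable.congr (f := fun x : ({0}ᶜ : Set E) => h x) ?_ (ae_of_all _ fun x => (hH x).symm)
    have : IntegrableOn h ({0}ᶜ : Set E) μ := hint.integrableOn
    rwa [integrableOn_iff_comap_subtypeVal (measurableSet_singleton _).compl] at this
  calc
    ∫ x in ball 0 1, k x ∂μ = ∫ x, h x ∂μ := (integral_indicator measurableSet_ball).symm
    _ = ∫ x : ({(0)}ᶜ : Set E), h x.1 ∂(μ.comap (↑)) := by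
      rw [integral_subtype_comap (measurableSet_singleton _).compl fun x ↦ h x,
        restrict_compl_singleton]
    _ = ∫ p, H p ∂μ.toSphere.prod (.volumeIoiPow n) := by
      rw [← hmp.integral_comp hemb]
      exact integral_congr_ae (ae_of_all _ fun x => (hH x).symm)
    _ = ∫ z, ∫ r, H (z, r) ∂(.volumeIoiPow n) ∂μ.toSphere := integral_prod _ hHint
    _ = _ := by
      congr 1 with z
      simp only [Measure.volumeIoiPow, ENNReal.ofReal]
      rw [integral_withDensity_eq_integral_smul]
      swap
      · exact (measurable_subtype_coe.pow_const _).real_toNNReal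
      rw [integral_subtype_comap measurableSet_Ioi
          fun a ↦ Real.toNNReal (a ^ n) • h (a • (z : E)),
        setIntegral_congr_fun (g := (Iio (1 : ℝ)).indicator fun r => r ^ n • k (r • (z : E)))
          measurableSet_Ioi, setIntegral_indicator measurableSet_Iio,
        intervalIntegral.integral_of_le zero_le_one, Ioi_inter_Iio,
        integral_Ioc_eq_integral_Ioo]
      intro r (hr : 0 < r)
      have hz : ‖(z : E)‖ = 1 := by simp
      simp only [NNReal.smul_def, Real.coe_toNNReal _ (pow_nonneg hr.le n), h, indicator, mem_ball,
        mem_Iio, dist_zero_right, norm_smul, hz, Real.norm_of_nonneg hr.le, mul_one]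
      split_ifs <;> simp

/-- The divergence theorem on the unit ball for the vector field `x ↦ v x • x`. -/
theorem integral_toSphere_eq_integral_ball [CompleteSpace V] {v : E → V} (hv : ContDiff ℝ 1 v) :
    ∫ z : sphere (0 : E) 1, v z ∂μ.toSphere =
      ∫ x in ball 0 1, ((Module.finrank ℝ E : ℝ) • v x + fderiv ℝ v x x) ∂μ := by
  have hf : Continuous fun x => fderiv ℝ v x x :=
    (hv.continuous_fderiv one_ne_zero).clm_apply continuous_id
  rw [integral_ball_eq_integral_toSphere μ (by have := hv.continuous; fun_prop)]
  congr 1 with z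
  obtain ⟨n, hn⟩ : ∃ n, Module.finrank ℝ E = n + 1 :=
    Nat.exists_eq_succ_of_ne_zero Module.finrank_pos.ne'
  rw [hn]
  -- The radial integrand is the derivative of r^(n+1) v(rz), so the inner integral is v(z).
  have hd : ∀ r : ℝ, HasDerivAt (fun r : ℝ => r ^ (n + 1) • v (r • (z : E)))
      (r ^ n • (((n + 1 : ℕ) : ℝ) • v (r • (z : E)) + fderiv ℝ v (r • (z : E)) (r • (z : E)))) r := by
    intro r
    have h1 : HasDerivAt (fun r : ℝ => v (r • (z : E))) (fderiv ℝ v (r • (z : E)) z) r := by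
      have h2 : HasDerivAt (fun r : ℝ => r • (z : E)) (z : E) r := by
        simpa using (hasDerivAt_id r).smul_const (z : E)
      exact ((hv.differentiable one_ne_zero) _).hasFDerivAt.comp_hasDerivAt r h2
    refine ((hasDerivAt_pow (n + 1) r).smul h1).congr_deriv ?_
    simp only [map_smul, smul_add, smul_smul, Nat.add_sub_cancel, pow_succ]
    rw [add_comm, mul_comm (r ^ n) (((n + 1 : ℕ) : ℝ)), mul_comm (r ^ n) r]
  simp only [Nat.add_sub_cancel]
  rw [intervalIntegral.integral_eq_sub_of_hasDerivAt (fun r _ => hd r)]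
  · simp
  · apply Continuous.intervalIntegrable
    have := hv.continuous
    have := hf.comp (f := fun r : ℝ => r • (z : E)) (by fun_prop)
    fun_prop

end Polar

/-! ### Bounds for the derivative of a smooth cutoff -/

section SmoothTransition

theorem Real.deriv_smoothTransition_of_nonpos {t : ℝ} (ht : t ≤ 0) :
    deriv Real.smoothTransition t = 0 :=
  IsLocalMin.deriv_eq_zero <| Eventually.of_forall fun s => by
    rw [Real.smoothTransition.zero_of_nonpos ht]; exact Real.smoothTransition.nonneg s

theorem Real.deriv_smoothTransition_of_one_le {t : ℝ} (ht : 1 ≤ t) :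
    deriv Real.smoothTransition t = 0 :=
  IsLocalMax.deriv_eq_zero <| Eventually.of_forall fun s => by
    rw [Real.smoothTransition.one_of_one_le ht]; exact Real.smoothTransition.le_one s

/-- The derivative vanishes off [0, 1], so compactness suffices. The bound dominates the boundary
layer term in Green's formula. -/
theorem Real.exists_bound_mul_deriv_smoothTransition :
    ∃ C, ∀ t, ‖t * deriv Real.smoothTransition t‖ ≤ C := by
  have hc : Continuous fun t => t * deriv Real.smoothTransition t :=
    continuous_id.mul ((Real.smoothTransition.contDiff (n := 1)).continuous_deriv le_rfl)
  obtain ⟨C, hC⟩ := isCompact_Icc.exists_bound_of_continuousOn (s := Icc (0 : ℝ) 1) hc.continuousOn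
  refine ⟨C, fun t => ?_⟩
  by_cases ht : t ∈ Icc (0 : ℝ) 1
  · exact hC t ht
  · have h0 : deriv Real.smoothTransition t = 0 := by
      rcases lt_or_ge t 0 with h | h
      · exact Real.deriv_smoothTransition_of_nonpos h.le
      · exact Real.deriv_smoothTransition_of_one_le (not_le.1 fun h' => ht ⟨h, h'⟩).le
    rw [h0, mul_zero, norm_zero]
    exact (norm_nonneg _).trans (hC 0 (by simp))

end SmoothTransition

/-! ### Integration by parts and Green's formula on the ball -/

section Green

variable {N : ℕ} {V : Type*} [NormedAddCommGroup V] [NormedSpace ℝ V]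

theorem integral_smul_fderiv_eq_neg_of_hasCompactSupport {E : Type*} [NormedAddCommGroup E]
    [NormedSpace ℝ E] [MeasurableSpace E] [BorelSpace E] [FiniteDimensional ℝ E] (μ : Measure E)
    [μ.IsAddHaarMeasure] {φ : E → ℝ} (hφ : ContDiff ℝ 1 φ) (hc : HasCompactSupport φ) {w : E → V}
    (hw : ContDiff ℝ 1 w) (a : E) :
    ∫ x, φ x • fderiv ℝ w x a ∂μ = - ∫ x, fderiv ℝ φ x a • w x ∂μ := by
  have hφ' : Continuous fun x => fderiv ℝ φ x a :=
    (hφ.continuous_fderiv one_ne_zero).clm_apply continuous_const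
  have hw' : Continuous fun x => fderiv ℝ w x a :=
    (hw.continuous_fderiv one_ne_zero).clm_apply continuous_const
  refine integral_smul_fderiv_eq_neg_fderiv_smul_of_integrable ?_ ?_ ?_
    (fun x _ => hφ.differentiable one_ne_zero x) (fun x _ => hw.differentiable one_ne_zero x)
  · exact (hφ'.smul hw.continuous).integrable_of_hasCompactSupport (hc.fderiv_apply ℝ a).smul_right
  · exact (hφ.continuous.smul hw').integrable_of_hasCompactSupport hc.smul_right
  · exact (hφ.continuous.smul hw.continuous).integrable_of_hasCompactSupport hc.smul_right

theorem EuclideanSpace.apply_eq_sum_smul_apply_single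
    (A : EuclideanSpace ℝ (Fin N) →L[ℝ] V) (x : EuclideanSpace ℝ (Fin N)) :
    A x = ∑ j, x j • A (EuclideanSpace.single j 1) := by
  conv_lhs => rw [← (EuclideanSpace.basisFun (Fin N) ℝ).sum_repr x]
  simp [map_sum]

/-- Integration by parts for the Euler vector field `x ↦ x`. -/
theorem integral_smul_fderiv_self_eq_neg {φ : EuclideanSpace ℝ (Fin N) → ℝ} (hφ : ContDiff ℝ 1 φ)
    (hc : HasCompactSupport φ) {w : EuclideanSpace ℝ (Fin N) → V} (hw : ContDiff ℝ 1 w) :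
    ∫ x, φ x • fderiv ℝ w x x = - ∫ x, (N * φ x + fderiv ℝ φ x x) • w x := by
  have hcoord : ∀ j : Fin N, ContDiff ℝ 1 fun x : EuclideanSpace ℝ (Fin N) => x j := fun j =>
    (EuclideanSpace.proj (𝕜 := ℝ) j : EuclideanSpace ℝ (Fin N) →L[ℝ] ℝ).contDiff
  have hψ : ∀ j : Fin N, ContDiff ℝ 1 fun x : EuclideanSpace ℝ (Fin N) => x j * φ x := fun j =>
    (hcoord j).mul hφ
  have hψc : ∀ j : Fin N, HasCompactSupport fun x : EuclideanSpace ℝ (Fin N) => x j * φ x :=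
    fun j => hc.mul_left
  have hderiv : ∀ (j : Fin N) (x : EuclideanSpace ℝ (Fin N)),
      fderiv ℝ (fun x : EuclideanSpace ℝ (Fin N) => x j * φ x) x (EuclideanSpace.single j 1) =
        φ x + x j * fderiv ℝ φ x (EuclideanSpace.single j 1) := by
    intro j x
    have h1 : HasFDerivAt (fun x : EuclideanSpace ℝ (Fin N) => x j)
        (EuclideanSpace.proj (𝕜 := ℝ) j : EuclideanSpace ℝ (Fin N) →L[ℝ] ℝ) x :=
      (EuclideanSpace.proj (𝕜 := ℝ) j : EuclideanSpace ℝ (Fin N) →L[ℝ] ℝ).hasFDerivAt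
    rw [fderiv_fun_mul h1.differentiableAt (hφ.differentiable one_ne_zero x), h1.fderiv]
    simp [add_comm]
  have hw' : ∀ a, Continuous fun x => fderiv ℝ w x a := fun a =>
    (hw.continuous_fderiv one_ne_zero).clm_apply continuous_const
  have hψ' : ∀ j a, Continuous fun x =>
      fderiv ℝ (fun x : EuclideanSpace ℝ (Fin N) => x j * φ x) x a := fun j a =>
    ((hψ j).continuous_fderiv one_ne_zero).clm_apply continuous_const
  calc
    ∫ x, φ x • fderiv ℝ w x x
      = ∫ x, ∑ j, (x j * φ x) • fderiv ℝ w x (EuclideanSpace.single j 1) := by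
        congr 1 with x
        rw [EuclideanSpace.apply_eq_sum_smul_apply_single (fderiv ℝ w x) x, Finset.smul_sum]
        exact Finset.sum_congr rfl fun j _ => by rw [smul_smul, mul_comm]
    _ = ∑ j, ∫ x, (x j * φ x) • fderiv ℝ w x (EuclideanSpace.single j 1) :=
        integral_finsetSum _ fun j _ => ((hψ j).continuous.smul
          (hw' _)).integrable_of_hasCompactSupport (hψc j).smul_right
    _ = - ∑ j, ∫ x, fderiv ℝ (fun x : EuclideanSpace ℝ (Fin N) => x j * φ x) x
          (EuclideanSpace.single j 1) • w x := by
        rw [← Finset.sum_neg_distrib]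
        exact Finset.sum_congr rfl fun j _ =>
          integral_smul_fderiv_eq_neg_of_hasCompactSupport volume (hψ j) (hψc j) hw _
    _ = - ∫ x, (N * φ x + fderiv ℝ φ x x) • w x := by
        rw [← integral_finsetSum]
        · congr 2 with x
          simp only [hderiv]
          rw [← Finset.sum_smul, Finset.sum_add_distrib, EuclideanSpace.apply_eq_sum_smul_apply_single (fderiv ℝ φ x) x]
          simp
        · exact fun j _ => ((hψ' j _).smul hw.continuous).integrable_of_hasCompactSupport
            ((hψc j).fderiv_apply ℝ _).smul_right

/-- The divergence theorem on the unit ball for the constant direction `a`. -/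
theorem integral_ball_fderiv_eq_integral_toSphere [NeZero N] [CompleteSpace V]
    {w : EuclideanSpace ℝ (Fin N) → V}
    (hw : ContDiff ℝ 1 w) (a : EuclideanSpace ℝ (Fin N)) :
    ∫ x in ball 0 1, fderiv ℝ w x a =
      ∫ z : sphere (0 : EuclideanSpace ℝ (Fin N)) 1, inner ℝ a (z : EuclideanSpace ℝ (Fin N)) • w z
        ∂(volume : Measure (EuclideanSpace ℝ (Fin N))).toSphere := by
  have : Nonempty (Fin N) := ⟨0⟩
  set ℓ : EuclideanSpace ℝ (Fin N) → ℝ := fun x => inner ℝ a x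
  have hℓ : ContDiff ℝ 1 ℓ := (innerSL ℝ a).contDiff
  have hℓ' : ∀ x v, fderiv ℝ ℓ x v = inner ℝ a v := fun x v => by
    have : HasFDerivAt ℓ (innerSL ℝ a) x := (innerSL ℝ a).hasFDerivAt
    rw [this.fderiv, innerSL_apply_apply]
  have hw' : Continuous fun x => fderiv ℝ w x a :=
    (hw.continuous_fderiv one_ne_zero).clm_apply continuous_const
  have hw'' : Continuous fun x => fderiv ℝ w x x :=
    (hw.continuous_fderiv one_ne_zero).clm_apply continuous_id
  have hwc := hw.continuous
  have hℓc := hℓ.continuous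
  -- K is the divergence of w times the field a - ⟨a, x⟩ x, which is tangential on the unit sphere,
  -- so its integral should vanish. The subtracted part comes from the radial divergence theorem for
  -- ℓ w; N + 1 arises because ℓ has degree 1.
  set K : EuclideanSpace ℝ (Fin N) → V := fun x =>
    fderiv ℝ w x a - (((N + 1) * ℓ x) • w x + ℓ x • fderiv ℝ w x x)
  have hK : Continuous K := by fun_prop
  have hKint : IntegrableOn K (ball 0 1) :=
    (hK.continuousOn.integrableOn_compact (isCompact_closedBall 0 1)).mono_set
      ball_subset_closedBall
  have hint1 : IntegrableOn (fun x => fderiv ℝ w x a) (ball 0 1) :=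
    (hw'.continuousOn.integrableOn_compact (isCompact_closedBall 0 1)).mono_set
      ball_subset_closedBall
  have hint2 : IntegrableOn (fun x => ((N + 1) * ℓ x) • w x + ℓ x • fderiv ℝ w x x) (ball 0 1) :=
    ((by fun_prop : Continuous fun x => ((N + 1) * ℓ x) • w x +
      ℓ x • fderiv ℝ w x x).continuousOn.integrableOn_compact (isCompact_closedBall 0 1)).mono_set
      ball_subset_closedBall
  rw [show (∫ z : sphere (0 : EuclideanSpace ℝ (Fin N)) 1,
      inner ℝ a (z : EuclideanSpace ℝ (Fin N)) • w z
      ∂(volume : Measure (EuclideanSpace ℝ (Fin N))).toSphere) =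
      ∫ x in ball 0 1, (((N + 1) * ℓ x) • w x + ℓ x • fderiv ℝ w x x) from ?_]
  swap
  · refine (integral_toSphere_eq_integral_ball volume (hℓ.smul hw)).trans ?_
    congr 1 with x
    rw [((hℓ.differentiable one_ne_zero x).hasFDerivAt.smul
      (hw.differentiable one_ne_zero x).hasFDerivAt).fderiv]
    simp only [finrank_euclideanSpace, Fintype.card_fin, add_apply,
      smul_apply, ContinuousLinearMap.smulRight_apply, hℓ']
    simp only [Pi.smul_apply', smul_smul]
    rw [add_mul, one_mul, add_smul, add_assoc, add_comm (ℓ x • _)]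
  rw [← sub_eq_zero, ← integral_sub hint1 hint2]
  set st := Real.smoothTransition
  set χ : ℕ → EuclideanSpace ℝ (Fin N) → ℝ := fun n x => st (n * (1 - ‖x‖ ^ 2))
  set θ : ℝ → ℝ := fun t => t * deriv st t
  have hχ : ∀ n, ContDiff ℝ 1 (χ n) := fun n =>
    (Real.smoothTransition.contDiff (n := 1)).comp
      (contDiff_const.mul (contDiff_const.sub (contDiff_norm_sq ℝ)))
  have hχ' : ∀ n x v, fderiv ℝ (χ n) x v =
      deriv st (n * (1 - ‖x‖ ^ 2)) * (n * (-(2 * inner ℝ x v))) := by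
    intro n x v
    have h1 : HasFDerivAt (fun x : EuclideanSpace ℝ (Fin N) => (n : ℝ) * (1 - ‖x‖ ^ 2))
        ((n : ℝ) • (-((2 : ℕ) • innerSL ℝ x) : EuclideanSpace ℝ (Fin N) →L[ℝ] ℝ)) x := by
      simpa using ((hasStrictFDerivAt_norm_sq x).hasFDerivAt.const_sub 1).const_mul (n : ℝ)
    have h2 : HasDerivAt st (deriv st (n * (1 - ‖x‖ ^ 2))) (n * (1 - ‖x‖ ^ 2)) :=
      ((Real.smoothTransition.contDiff (n := 1)).differentiable one_ne_zero _).hasDerivAt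
    rw [show χ n = st ∘ fun x => (n : ℝ) * (1 - ‖x‖ ^ 2) from rfl, (h2.comp_hasFDerivAt x h1).fderiv]
    simp [innerSL_apply_apply]
  have hout : ∀ n : ℕ, ∀ x ∉ ball (0 : EuclideanSpace ℝ (Fin N)) 1, (n : ℝ) * (1 - ‖x‖ ^ 2) ≤ 0 := by
    intro n x hx
    have : 1 ≤ ‖x‖ := by simpa using hx
    exact mul_nonpos_of_nonneg_of_nonpos (by positivity) (by nlinarith)
  have hχc : ∀ n, HasCompactSupport (χ n) := fun n =>
    HasCompactSupport.of_support_subset_isCompact (isCompact_closedBall 0 1) fun x hx => by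
      by_contra h
      exact hx (Real.smoothTransition.zero_of_nonpos
        (hout n x fun h' => h (ball_subset_closedBall h')))
  -- The gradient of χ n has size n, but it is radial, and the radial component of a - ⟨a, x⟩ x is
  -- ℓ(x)(1 - |x|²)/|x|. The factor 1 - |x|² absorbs n, leaving the bounded θ.
  have key : ∀ n, ∫ x in ball 0 1, χ n x • K x =
      ∫ x in ball 0 1, (2 * ℓ x * θ (n * (1 - ‖x‖ ^ 2))) • w x := by
    intro n
    have hcχ := (hχ n).continuous
    have hχ1 : Continuous fun x => fderiv ℝ (χ n) x a :=
      ((hχ n).continuous_fderiv one_ne_zero).clm_apply continuous_const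
    have hχ2 : Continuous fun x => fderiv ℝ (χ n) x x :=
      ((hχ n).continuous_fderiv one_ne_zero).clm_apply continuous_id
    have hc : ∀ {h : EuclideanSpace ℝ (Fin N) → V}, Continuous h →
        (∀ x, χ n x = 0 → fderiv ℝ (χ n) x = 0 → h x = 0) → Integrable h := by
      intro h hh h0
      refine hh.integrable_of_hasCompactSupport
        (HasCompactSupport.of_support_subset_isCompact (hχc n) fun x hx => ?_)
      by_contra hx'
      refine hx (h0 x (image_eq_zero_of_notMem_tsupport hx') ?_)
      exact image_eq_zero_of_notMem_tsupport fun h => hx' (tsupport_fderiv_subset ℝ h)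
    rw [setIntegral_eq_integral_of_forall_compl_eq_zero,
      setIntegral_eq_integral_of_forall_compl_eq_zero]
    · have e1 := integral_smul_fderiv_eq_neg_of_hasCompactSupport volume (hχ n) (hχc n) hw a
      have e2 := integral_smul_fderiv_self_eq_neg ((hχ n).mul hℓ) (hχc n).mul_right hw
      have e3 : ∀ x, fderiv ℝ (fun x => χ n x * ℓ x) x x =
          ℓ x * χ n x + ℓ x * fderiv ℝ (χ n) x x := fun x => by
        rw [fderiv_fun_mul ((hχ n).differentiable one_ne_zero x)
          (hℓ.differentiable one_ne_zero x)]
        simp [hℓ', mul_comm, ℓ]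
      simp only [e3] at e2
      calc ∫ x, χ n x • K x
          = ∫ x, (χ n x • fderiv ℝ w x a - (((N + 1) * χ n x * ℓ x) • w x
              + (χ n x * ℓ x) • fderiv ℝ w x x)) := by
            congr 1 with x
            simp only [K, smul_sub, smul_add, smul_smul]
            congr 3; ring
        _ = (∫ x, χ n x • fderiv ℝ w x a) - ((∫ x, ((N + 1) * χ n x * ℓ x) • w x)
              + ∫ x, (χ n x * ℓ x) • fderiv ℝ w x x) := by
            rw [← integral_add, ← integral_sub]
            all_goals
              refine hc (by fun_prop) fun x h _ => by simp [h]
        _ = (∫ x, -(fderiv ℝ (χ n) x a • w x)) - ((∫ x, ((N + 1) * χ n x * ℓ x) • w x)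
              + ∫ x, -((N * (χ n x * ℓ x) +
                (ℓ x * χ n x + ℓ x * fderiv ℝ (χ n) x x)) • w x)) := by
            rw [e1, e2, integral_neg, integral_neg]
        _ = ∫ x, (-(fderiv ℝ (χ n) x a • w x) - (((N + 1) * χ n x * ℓ x) • w x
              + -((N * (χ n x * ℓ x) +
                (ℓ x * χ n x + ℓ x * fderiv ℝ (χ n) x x)) • w x))) := by
            rw [← integral_add, ← integral_sub]
            all_goals
              refine hc (by fun_prop) fun x h h' => by simp [h, h']
        _ = _ := by
            congr 1 with x
            simp only [← neg_smul, ← add_smul, ← sub_smul, hχ', θ]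
            congr 1
            simp only [ℓ]
            rw [real_inner_self_eq_norm_sq, real_inner_comm x a]
            ring
    · intro x hx
      simp only [θ, st, Real.deriv_smoothTransition_of_nonpos (hout n x hx)]
      simp
    · intro x hx
      simp only [χ, st, Real.smoothTransition.zero_of_nonpos (hout n x hx), zero_smul]
  obtain ⟨C, hC⟩ := Real.exists_bound_mul_deriv_smoothTransition
  -- At a fixed interior point, χ n is eventually 1 and θ eventually 0; both sides of `key` then
  -- pass to the limit.
  have hlarge : ∀ x ∈ ball (0 : EuclideanSpace ℝ (Fin N)) 1,
      ∀ᶠ n : ℕ in atTop, 1 ≤ (n : ℝ) * (1 - ‖x‖ ^ 2) := by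
    intro x hx
    have hx1 : ‖x‖ < 1 := by simpa using hx
    have : 0 < 1 - ‖x‖ ^ 2 := by nlinarith [norm_nonneg x]
    exact (tendsto_natCast_atTop_atTop.atTop_mul_const this).eventually_ge_atTop 1
  have lim1 : Tendsto (fun n => ∫ x in ball 0 1, χ n x • K x) atTop (𝓝 (∫ x in ball 0 1, K x)) := by
    refine tendsto_integral_of_dominated_convergence (fun x => ‖K x‖)
      (fun n => ((hχ n).continuous.smul hK).aestronglyMeasurable) hKint.norm (fun n => ?_) ?_
    · refine ae_of_all _ fun x => ?_
      rw [norm_smul, Real.norm_of_nonneg (Real.smoothTransition.nonneg _)]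
      exact mul_le_of_le_one_left (norm_nonneg _) (Real.smoothTransition.le_one _)
    · filter_upwards [ae_restrict_mem measurableSet_ball] with x hx
      refine tendsto_const_nhds.congr' ?_
      filter_upwards [hlarge x hx] with n hn
      simp only [χ, st, Real.smoothTransition.one_of_one_le hn, one_smul]
  have lim2 : Tendsto (fun n : ℕ => ∫ x in ball 0 1, (2 * ℓ x * θ (n * (1 - ‖x‖ ^ 2))) • w x) atTop
      (𝓝 (∫ x in ball (0 : EuclideanSpace ℝ (Fin N)) 1, (0 : V))) := by
    have hθ : Continuous θ :=
      continuous_id.mul ((Real.smoothTransition.contDiff (n := 1)).continuous_deriv le_rfl)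
    refine tendsto_integral_of_dominated_convergence (fun x => ‖2 * ℓ x‖ * C * ‖w x‖)
      (fun n => (by fun_prop : Continuous fun x => (2 * ℓ x *
        θ (n * (1 - ‖x‖ ^ 2))) • w x).aestronglyMeasurable)
      (((by fun_prop : Continuous fun x => ‖2 * ℓ x‖ * C *
        ‖w x‖).continuousOn.integrableOn_compact (isCompact_closedBall 0 1)).mono_set
        ball_subset_closedBall) (fun n => ?_) ?_
    · refine ae_of_all _ fun x => ?_
      rw [norm_smul, norm_mul]
      gcongr
      exact hC _
    · filter_upwards [ae_restrict_mem measurableSet_ball] with x hx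
      refine tendsto_const_nhds.congr' ?_
      filter_upwards [hlarge x hx] with n hn
      simp only [θ, st, Real.deriv_smoothTransition_of_one_le hn, mul_zero, zero_smul]
  simp only [key] at lim1
  simpa using tendsto_nhds_unique lim1 lim2

end Green

/-! ### Pairings and convergence in L² -/

section LpTwo

variable {α W : Type*} [MeasurableSpace α] {μ : Measure α} [NormedAddCommGroup W]

theorem eLpNorm_two_sq (g : α → W) : eLpNorm g 2 μ ^ 2 = ∫⁻ x, ‖g x‖ₑ ^ 2 ∂μ := by
  rw [eLpNorm_eq_lintegral_rpow_enorm_toReal two_ne_zero (by simp)]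
  simp only [ENNReal.toReal_ofNat, ENNReal.rpow_ofNat]
  rw [← ENNReal.rpow_natCast, ← ENNReal.rpow_mul]
  norm_num

theorem eLpNorm_one_smul_le [NormedSpace ℝ W] {φ : α → ℝ} {g : α → W}
    (hφ : AEStronglyMeasurable φ μ) (hg : AEStronglyMeasurable g μ) :
    eLpNorm (fun x => φ x • g x) 1 μ ≤ eLpNorm φ 2 μ * eLpNorm g 2 μ :=
  eLpNorm_smul_le_mul_eLpNorm hg hφ

theorem MemLp.integrable_smul_two [NormedSpace ℝ W] {φ : α → ℝ} {g : α → W}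
    (hφ : MemLp φ 2 μ) (hg : MemLp g 2 μ) : Integrable (fun x => φ x • g x) μ :=
  memLp_one_iff_integrable.1 (hg.smul hφ)

theorem enorm_integral_smul_le [NormedSpace ℝ W] {φ : α → ℝ} {g : α → W}
    (hφ : AEStronglyMeasurable φ μ) (hg : AEStronglyMeasurable g μ) :
    ‖∫ x, φ x • g x ∂μ‖ₑ ≤ eLpNorm φ 2 μ * eLpNorm g 2 μ :=
  (enorm_integral_le_lintegral_enorm _).trans
    (eLpNorm_one_eq_lintegral_enorm.symm.le.trans (eLpNorm_one_smul_le hφ hg))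

/-- Convergence in `L²` implies convergence of the integrals against a fixed `L²` function. -/
theorem tendsto_integral_smul_of_tendsto_eLpNorm_two [NormedSpace ℝ W]
    {φ : α → ℝ} {g : α → W} {u : ℕ → α → W}
    (hφ : MemLp φ 2 μ) (hg : MemLp g 2 μ) (hu : ∀ n, MemLp (u n) 2 μ)
    (h : Tendsto (fun n => eLpNorm (fun x => u n x - g x) 2 μ) atTop (𝓝 0)) :
    Tendsto (fun n => ∫ x, φ x • u n x ∂μ) atTop (𝓝 (∫ x, φ x • g x ∂μ)) := by
  refine tendsto_integral_of_L1' _ (MemLp.integrable_smul_two hφ hg).1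
    (Eventually.of_forall fun n => MemLp.integrable_smul_two hφ (hu n)) ?_
  have h0 : Tendsto (fun n => eLpNorm φ 2 μ * eLpNorm (fun x => u n x - g x) 2 μ) atTop (𝓝 0) := by
    simpa using ENNReal.Tendsto.const_mul h (Or.inr hφ.eLpNorm_ne_top)
  refine tendsto_of_tendsto_of_tendsto_of_le_of_le tendsto_const_nhds h0 (fun _ => zero_le)
    fun n => ?_
  refine (eLpNorm_congr_ae (ae_of_all _ fun x => ?_)).le.trans
    (eLpNorm_one_smul_le hφ.1 ((hu n).1.sub hg.1))
  simp [smul_sub]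

theorem exists_eventually_eLpNorm_le {g : α → W} {u : ℕ → α → W}
    (hg : MemLp g 2 μ) (hu : ∀ n, MemLp (u n) 2 μ)
    (h : Tendsto (fun n => eLpNorm (fun x => u n x - g x) 2 μ) atTop (𝓝 0)) :
    ∃ M : ENNReal, M ≠ ⊤ ∧ ∀ᶠ n in atTop, eLpNorm (u n) 2 μ ≤ M := by
  refine ⟨1 + eLpNorm g 2 μ, by simp [hg.eLpNorm_ne_top], ?_⟩
  filter_upwards [h.eventually_le_const one_pos] with n hn
  calc eLpNorm (u n) 2 μ = eLpNorm ((fun x => u n x - g x) + g) 2 μ := by congr 1; ext; simp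
    _ ≤ _ := eLpNorm_add_le ((hu n).1.sub hg.1) hg.1 one_le_two
    _ ≤ _ := by gcongr

end LpTwo

/-! ### The trace inequality and the boundary functional -/

section Trace

variable {N : ℕ} {𝕜 : Type*} [RCLike 𝕜]

theorem Continuous.memLp_restrict_ball {W : Type*} [NormedAddCommGroup W]
    {g : EuclideanSpace ℝ (Fin N) → W} (hg : Continuous g) (p : ENNReal)
    (x : EuclideanSpace ℝ (Fin N)) (r : ℝ) : MemLp g p (volume.restrict (ball x r)) := by
  obtain ⟨C, hC⟩ := (isCompact_closedBall x r).exists_bound_of_continuousOn hg.continuousOn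
  have : IsFiniteMeasure ((volume : Measure (EuclideanSpace ℝ (Fin N))).restrict (ball x r)) :=
    ⟨by simpa using measure_ball_lt_top⟩
  exact MemLp.of_bound hg.aestronglyMeasurable C <|
    (ae_restrict_mem measurableSet_ball).mono fun y hy => hC y (ball_subset_closedBall hy)

theorem Continuous.memLp_toSphere {W : Type*} [NormedAddCommGroup W]
    {g : sphere (0 : EuclideanSpace ℝ (Fin N)) 1 → W} (hg : Continuous g) (p : ENNReal) :
    MemLp g p (volume : Measure (EuclideanSpace ℝ (Fin N))).toSphere := by
  obtain ⟨C, hC⟩ := isCompact_univ.exists_bound_of_continuousOn hg.continuousOn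
  exact MemLp.of_bound hg.aestronglyMeasurable C (ae_of_all _ fun y => hC y (mem_univ y))

theorem ContDiff.continuous_partialDeriv {u : EuclideanSpace ℝ (Fin N) → 𝕜}
    (hu : ContDiff ℝ 1 u) (i : Fin N) : Continuous (partialDeriv i u) :=
  (hu.continuous_fderiv one_ne_zero).clm_apply continuous_const

theorem partialDeriv_smul {φ : EuclideanSpace ℝ (Fin N) → ℝ} {u : EuclideanSpace ℝ (Fin N) → 𝕜}
    {x : EuclideanSpace ℝ (Fin N)} (hφ : DifferentiableAt ℝ φ x) (hu : DifferentiableAt ℝ u x)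
    (i : Fin N) : partialDeriv i (fun x => φ x • u x) x =
      partialDeriv i φ x • u x + φ x • partialDeriv i u x := by
  simp only [partialDeriv]
  rw [fderiv_fun_smul hφ hu]
  simp [add_comm]

/-- The trace inequality for continuously differentiable functions. -/
theorem eLpNorm_toSphere_sq_le [NeZero N] {u : EuclideanSpace ℝ (Fin N) → 𝕜}
    (hu : ContDiff ℝ 1 u) :
    eLpNorm (fun z : sphere (0 : EuclideanSpace ℝ (Fin N)) 1 => u z) 2
        (volume : Measure (EuclideanSpace ℝ (Fin N))).toSphere ^ 2 ≤
      (2 * N + 4 : ℕ) * (eLpNorm u 2 (volume.restrict (ball 0 1)) ^ 2 +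
        ∑ i, eLpNorm (partialDeriv i u) 2 (volume.restrict (ball 0 1)) ^ 2) := by
  have : Nonempty (Fin N) := ⟨0⟩
  -- The radial divergence theorem is applied to |u|².
  set v : EuclideanSpace ℝ (Fin N) → ℝ := fun x => ‖u x‖ ^ 2
  have hvr : v = fun x => RCLike.re (u x) ^ 2 + RCLike.im (u x) ^ 2 := by
    ext x
    simp only [v]
    rw [← RCLike.normSq_eq_def', RCLike.normSq_apply]
    ring
  have hv : ContDiff ℝ 1 v := by
    rw [hvr]
    exact ((RCLike.reCLM.contDiff.comp hu).pow 2).add ((RCLike.imCLM.contDiff.comp hu).pow 2)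
  have hdv : ∀ x, fderiv ℝ v x x =
      2 * RCLike.re (u x) * RCLike.re (fderiv ℝ u x x) +
      2 * RCLike.im (u x) * RCLike.im (fderiv ℝ u x x) := by
    intro x
    have h := (hu.differentiable one_ne_zero x).hasFDerivAt
    have h1 : HasFDerivAt (fun x => RCLike.re (u x)) (RCLike.reCLM.comp (fderiv ℝ u x)) x :=
      RCLike.reCLM.hasFDerivAt.comp x h
    have h2 : HasFDerivAt (fun x => RCLike.im (u x)) (RCLike.imCLM.comp (fderiv ℝ u x)) x :=
      RCLike.imCLM.hasFDerivAt.comp x h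
    have h3 : HasFDerivAt (fun x => RCLike.re (u x) ^ 2 + RCLike.im (u x) ^ 2) _ x :=
      (h1.pow 2).add (h2.pow 2)
    rw [hvr, h3.fderiv]
    simp
  -- The left side is at most (N + 1)|u|² + |du(x)|², and |du(x)|² ≤ N ∑ |∂_i u|² as |x| ≤ 1. The
  -- constant 2N + 4 is not sharp.
  have hbound : ∀ x ∈ ball (0 : EuclideanSpace ℝ (Fin N)) 1,
      (Module.finrank ℝ (EuclideanSpace ℝ (Fin N)) : ℝ) • v x + fderiv ℝ v x x ≤
      (2 * N + 4 : ℕ) * (‖u x‖ ^ 2 + ∑ i, ‖partialDeriv i u x‖ ^ 2) := by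
    intro x hx
    have hx1 : ‖x‖ ≤ 1 := (by simpa using hx : ‖x‖ < 1).le
    have h1 : ‖fderiv ℝ u x x‖ ^ 2 ≤ N * ∑ i, ‖partialDeriv i u x‖ ^ 2 := by
      rw [EuclideanSpace.apply_eq_sum_smul_apply_single (fderiv ℝ u x) x]
      have hle : ‖∑ j, x j • fderiv ℝ u x (EuclideanSpace.single j 1)‖ ≤
          ∑ j, ‖partialDeriv j u x‖ := by
        refine (norm_sum_le _ _).trans (Finset.sum_le_sum fun j _ => ?_)
        rw [norm_smul]
        exact mul_le_of_le_one_left (norm_nonneg _) ((PiLp.norm_apply_le x j).trans hx1)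
      refine (pow_le_pow_left₀ (norm_nonneg _) hle 2).trans ?_
      simpa using sq_sum_le_card_mul_sum_sq (s := (Finset.univ : Finset (Fin N)))
        (f := fun j => ‖partialDeriv j u x‖)
    have h2 : ∀ a b : ℝ, 2 * a * b ≤ a ^ 2 + b ^ 2 := fun a b => two_mul_le_add_sq a b
    have h3 : ∀ z : 𝕜, RCLike.re z ^ 2 + RCLike.im z ^ 2 = ‖z‖ ^ 2 := fun z => by
      rw [← RCLike.normSq_eq_def', RCLike.normSq_apply]; ring
    have h4 : fderiv ℝ v x x ≤ ‖u x‖ ^ 2 + ‖fderiv ℝ u x x‖ ^ 2 := by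
      rw [hdv]
      linarith [h2 (RCLike.re (u x)) (RCLike.re (fderiv ℝ u x x)), h3 (u x), h3 (fderiv ℝ u x x),
        h2 (RCLike.im (u x)) (RCLike.im (fderiv ℝ u x x))]
    have h5 : 0 ≤ ∑ i, ‖partialDeriv i u x‖ ^ 2 := Finset.sum_nonneg fun _ _ => by positivity
    simp only [finrank_euclideanSpace, Fintype.card_fin, v, smul_eq_mul]
    push_cast
    nlinarith [mul_nonneg (Nat.cast_nonneg (α := ℝ) N) h5, sq_nonneg ‖u x‖,
      mul_nonneg (Nat.cast_nonneg (α := ℝ) N) (sq_nonneg ‖u x‖)]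
  have hsq : ∀ z : 𝕜, ‖z‖ₑ ^ 2 = ENNReal.ofReal (‖z‖ ^ 2) := fun z => by
    rw [ENNReal.ofReal_pow (norm_nonneg _), ofReal_norm]
  have hcu := hu.continuous
  have hcv := hv.continuous
  have hcp := fun i => hu.continuous_partialDeriv i
  have hint : Integrable (fun z : sphere (0 : EuclideanSpace ℝ (Fin N)) 1 => v z)
      (volume : Measure (EuclideanSpace ℝ (Fin N))).toSphere :=
    memLp_one_iff_integrable.1 (Continuous.memLp_toSphere (by fun_prop) 1)
  rw [eLpNorm_two_sq]
  calc
    _ = ENNReal.ofReal (∫ z : sphere (0 : EuclideanSpace ℝ (Fin N)) 1, v z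
          ∂(volume : Measure (EuclideanSpace ℝ (Fin N))).toSphere) := by
        rw [ofReal_integral_eq_lintegral_ofReal hint (ae_of_all _ fun z => by positivity)]
        simp only [hsq, v]
    _ ≤ ENNReal.ofReal (∫ x in ball 0 1,
          (2 * N + 4 : ℕ) * (‖u x‖ ^ 2 + ∑ i, ‖partialDeriv i u x‖ ^ 2)) := by
        rw [integral_toSphere_eq_integral_ball volume hv]
        refine ENNReal.ofReal_le_ofReal (setIntegral_mono_on ?_ ?_ measurableSet_ball hbound)
        · have : Continuous fun x => fderiv ℝ v x x :=
            (hv.continuous_fderiv one_ne_zero).clm_apply continuous_id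
          exact memLp_one_iff_integrable.1 (Continuous.memLp_restrict_ball (by fun_prop) 1 0 1)
        · exact memLp_one_iff_integrable.1 (Continuous.memLp_restrict_ball (by fun_prop) 1 0 1)
    _ = ∫⁻ x in ball 0 1, ((2 * N + 4 : ℕ) : ENNReal) *
          (‖u x‖ₑ ^ 2 + ∑ i, ‖partialDeriv i u x‖ₑ ^ 2) := by
        rw [ofReal_integral_eq_lintegral_ofReal]
        · congr 1 with x
          rw [ENNReal.ofReal_mul (Nat.cast_nonneg _), ENNReal.ofReal_natCast,
            ENNReal.ofReal_add (by positivity) (Finset.sum_nonneg fun _ _ => by positivity),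
            ENNReal.ofReal_sum_of_nonneg fun _ _ => by positivity]
          simp only [hsq]
        · exact memLp_one_iff_integrable.1 (Continuous.memLp_restrict_ball (by fun_prop) 1 0 1)
        · exact ae_of_all _ fun x => mul_nonneg (Nat.cast_nonneg _)
            (add_nonneg (by positivity) (Finset.sum_nonneg fun _ _ => by positivity))
    _ = _ := by
        simp only [eLpNorm_two_sq]
        rw [lintegral_const_mul, lintegral_add_left, lintegral_finsetSum]
        · intro i _; have := hcp i; fun_prop
        · fun_prop
        · fun_prop

/-- The functional which Green's formula identifies with the integral over the unit sphere of the
product of `ψ`, of the trace of `f` and of the `i`-th component of the normal, if `g` is the `i`-th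
weak partial derivative of `f`. -/
noncomputable def boundaryFunctional (i : Fin N) (f g : EuclideanSpace ℝ (Fin N) → 𝕜)
    (ψ : EuclideanSpace ℝ (Fin N) → ℝ) : 𝕜 :=
  ∫ x in ball 0 1, (partialDeriv i ψ x • f x + ψ x • g x)

/-- Green's formula turns the functional into the integral of z_i ψ u over the sphere; then |z_i| ≤
1 and Cauchy–Schwarz apply. -/
theorem enorm_boundaryFunctional_le_of_contDiff [NeZero N] {u : EuclideanSpace ℝ (Fin N) → 𝕜}
    (hu : ContDiff ℝ 1 u) {ψ : EuclideanSpace ℝ (Fin N) → ℝ} (hψ : ContDiff ℝ 1 ψ) (i : Fin N) :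
    ‖boundaryFunctional i u (partialDeriv i u) ψ‖ₑ ≤
      eLpNorm (fun z : sphere (0 : EuclideanSpace ℝ (Fin N)) 1 => ψ z) 2
        (volume : Measure (EuclideanSpace ℝ (Fin N))).toSphere *
      eLpNorm (fun z : sphere (0 : EuclideanSpace ℝ (Fin N)) 1 => u z) 2
        (volume : Measure (EuclideanSpace ℝ (Fin N))).toSphere := by
  have hcu := hu.continuous
  have hcψ := hψ.continuous
  have e : boundaryFunctional i u (partialDeriv i u) ψ =
      ∫ z : sphere (0 : EuclideanSpace ℝ (Fin N)) 1, (z.1 i * ψ z) • u z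
        ∂(volume : Measure (EuclideanSpace ℝ (Fin N))).toSphere := by
    rw [boundaryFunctional]
    calc _ = ∫ x in ball 0 1, fderiv ℝ (fun x => ψ x • u x) x (EuclideanSpace.single i 1) := by
          congr 1 with x
          exact (partialDeriv_smul (hψ.differentiable one_ne_zero x)
            (hu.differentiable one_ne_zero x) i).symm
      _ = _ := by
          refine (integral_ball_fderiv_eq_integral_toSphere (hψ.smul hu) _).trans ?_
          congr 1 with z
          simp [EuclideanSpace.inner_single_left, mul_smul]
  rw [e]
  refine (enorm_integral_smul_le (Continuous.aestronglyMeasurable (by fun_prop))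
    (Continuous.aestronglyMeasurable (by fun_prop))).trans ?_
  gcongr
  refine eLpNorm_mono fun z => ?_
  rw [norm_mul]
  refine mul_le_of_le_one_left (norm_nonneg _) ((PiLp.norm_apply_le z.1 i).trans ?_)
  simp

/-- Both terms are L² pairings with fixed functions. This carries boundary estimates from C¹
functions to H¹ limits. -/
theorem tendsto_boundaryFunctional {u : ℕ → EuclideanSpace ℝ (Fin N) → 𝕜}
    {f g : EuclideanSpace ℝ (Fin N) → 𝕜} (hu : ∀ n, ContDiff ℝ 1 (u n)) (i : Fin N)
    (hf : MemLp f 2 (volume.restrict (ball 0 1))) (hg : MemLp g 2 (volume.restrict (ball 0 1)))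
    (h : Tendsto (fun n => eLpNorm (fun x => u n x - f x) 2 (volume.restrict (ball 0 1)))
      atTop (𝓝 0))
    (h' : Tendsto (fun n => eLpNorm (fun x => partialDeriv i (u n) x - g x) 2
      (volume.restrict (ball 0 1))) atTop (𝓝 0))
    {ψ : EuclideanSpace ℝ (Fin N) → ℝ} (hψ : ContDiff ℝ 1 ψ) :
    Tendsto (fun n => boundaryFunctional i (u n) (partialDeriv i (u n)) ψ) atTop
      (𝓝 (boundaryFunctional i f g ψ)) := by
  have m1 := (hψ.continuous_partialDeriv i).memLp_restrict_ball 2 0 1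
  have m2 := hψ.continuous.memLp_restrict_ball 2 0 1
  have m3 := fun n => (hu n).continuous.memLp_restrict_ball 2 0 1
  have m4 := fun n => ((hu n).continuous_partialDeriv i).memLp_restrict_ball 2 0 1
  have := (tendsto_integral_smul_of_tendsto_eLpNorm_two m1 hf m3 h).add
    (tendsto_integral_smul_of_tendsto_eLpNorm_two m2 hg m4 h')
  rw [← integral_add (MemLp.integrable_smul_two m1 hf) (MemLp.integrable_smul_two m2 hg)] at this
  refine this.congr fun n => ?_
  rw [← integral_add (MemLp.integrable_smul_two m1 (m3 n)) (MemLp.integrable_smul_two m2 (m4 n))]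
  rfl

/-- A function which is approximated in `H¹` by continuously differentiable functions has a trace
in `L²`: its boundary functional is `L²`-bounded. -/
theorem exists_enorm_boundaryFunctional_le [NeZero N] {u : ℕ → EuclideanSpace ℝ (Fin N) → 𝕜}
    {f : EuclideanSpace ℝ (Fin N) → 𝕜} {G : Fin N → EuclideanSpace ℝ (Fin N) → 𝕜}
    (hu : ∀ n, ContDiff ℝ 1 (u n))
    (hf : MemLp f 2 (volume.restrict (ball 0 1)))
    (hG : ∀ i, MemLp (G i) 2 (volume.restrict (ball 0 1)))
    (h : Tendsto (fun n => eLpNorm (fun x => u n x - f x) 2 (volume.restrict (ball 0 1)))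
      atTop (𝓝 0))
    (h' : ∀ i, Tendsto (fun n => eLpNorm (fun x => partialDeriv i (u n) x - G i x) 2
      (volume.restrict (ball 0 1))) atTop (𝓝 0)) :
    ∃ M : ENNReal, M ≠ ⊤ ∧ ∀ i, ∀ ψ : EuclideanSpace ℝ (Fin N) → ℝ, ContDiff ℝ 1 ψ →
      ‖boundaryFunctional i f (G i) ψ‖ₑ ≤
        eLpNorm (fun z : sphere (0 : EuclideanSpace ℝ (Fin N)) 1 => ψ z) 2
          (volume : Measure (EuclideanSpace ℝ (Fin N))).toSphere * M := by
  have m3 := fun n => (hu n).continuous.memLp_restrict_ball 2 0 1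
  have m4 := fun n i => ((hu n).continuous_partialDeriv i).memLp_restrict_ball 2 0 1
  obtain ⟨M₀, hM₀, hb₀⟩ := exists_eventually_eLpNorm_le hf m3 h
  choose M hM hb using fun i => exists_eventually_eLpNorm_le (hG i) (fun n => m4 n i) (h' i)
  -- The trace inequality bounds a square; a ≤ 1 + a² avoids taking a root.
  refine ⟨1 + (2 * N + 4 : ℕ) * (M₀ ^ 2 + ∑ i, M i ^ 2), ?_, fun i ψ hψ => ?_⟩
  · refine ENNReal.add_ne_top.2 ⟨by simp, ENNReal.mul_ne_top (ENNReal.natCast_ne_top _) ?_⟩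
    exact ENNReal.add_ne_top.2 ⟨ENNReal.pow_ne_top hM₀,
      ENNReal.sum_ne_top.2 fun i _ => ENNReal.pow_ne_top (hM i)⟩
  · refine le_of_tendsto (tendsto_boundaryFunctional hu i hf (hG i) h (h' i) hψ).enorm ?_
    filter_upwards [hb₀, eventually_all.2 hb] with n hn₀ hn
    refine (enorm_boundaryFunctional_le_of_contDiff (hu n) hψ i).trans ?_
    gcongr
    have hle : ∀ a : ENNReal, a ≤ 1 + a ^ 2 := fun a => by
      rcases le_total a 1 with ha | ha
      · exact ha.trans le_self_add
      · exact (le_self_pow₀ ha two_ne_zero).trans le_add_self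
    refine (hle _).trans ?_
    gcongr
    refine (eLpNorm_toSphere_sq_le (hu n)).trans ?_
    gcongr with i
    exact hn i

/-- If the trace vanishes then so does the boundary functional. -/
theorem HasTrace.exists_boundaryFunctional_eq_zero [NeZero N] {f : EuclideanSpace ℝ (Fin N) → 𝕜}
    (hf : HasTrace f 0) :
    ∃ G, HasH1Gradient (ball 0 1) f G ∧ ∀ i, ∀ ψ : EuclideanSpace ℝ (Fin N) → ℝ,
      IsTestFunction univ ψ → boundaryFunctional i f (G i) ψ = 0 := by
  obtain ⟨-, u, hu, ⟨G, hG, h, h'⟩, h0⟩ := hf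
  refine ⟨G, hG, fun i ψ hψ => ?_⟩
  have hψ1 : ContDiff ℝ 1 ψ := hψ.1.of_le (by exact_mod_cast le_top)
  have lim := (tendsto_boundaryFunctional hu i hG.memLp (hG.memLp_grad i) h (h' i) hψ1).enorm
  have m : MemLp (fun z : sphere (0 : EuclideanSpace ℝ (Fin N)) 1 => ψ z) 2
      (volume : Measure (EuclideanSpace ℝ (Fin N))).toSphere :=
    Continuous.memLp_toSphere (by have := hψ1.continuous; fun_prop) 2
  have h0' := ENNReal.Tendsto.const_mul h0 (Or.inr m.eLpNorm_ne_top)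
  simp only [Pi.zero_apply, sub_zero, mul_zero] at h0'
  have := le_of_tendsto_of_tendsto' lim h0' fun n =>
    enorm_boundaryFunctional_le_of_contDiff (hu n) hψ1 i
  simpa using this

end Trace

/-! ### Lebesgue measure under affine maps -/

section Affine

variable {E : Type*} [NormedAddCommGroup E] [NormedSpace ℝ E] [MeasurableSpace E] [BorelSpace E]

theorem measurableEmbedding_smul_add {r : ℝ} (hr : r ≠ 0) (c : E) :
    MeasurableEmbedding (fun x : E => r • x + c) :=
  ((Homeomorph.smulOfNeZero r hr).trans (Homeomorph.addRight c)).measurableEmbedding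

variable [FiniteDimensional ℝ E] (μ : Measure E) [μ.IsAddHaarMeasure]

theorem map_smul_add_addHaar {r : ℝ} (hr : r ≠ 0) (c : E) :
    μ.map (fun x => r • x + c) = ENNReal.ofReal |(r ^ Module.finrank ℝ E)⁻¹| • μ := by
  have : (fun x : E => r • x + c) = (fun x => x + c) ∘ (r • ·) := rfl
  rw [this, ← Measure.map_map (measurable_add_const c) (measurable_const_smul r),
    Measure.map_addHaar_smul μ hr, Measure.map_smul, map_add_right_eq_self]

theorem lintegral_comp_smul_add {r : ℝ} (hr : r ≠ 0) (c : E) (k : E → ENNReal) :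
    ∫⁻ x, k (r • x + c) ∂μ = ENNReal.ofReal |(r ^ Module.finrank ℝ E)⁻¹| * ∫⁻ x, k x ∂μ := by
  rw [← (measurableEmbedding_smul_add hr c).lintegral_map, map_smul_add_addHaar μ hr,
    lintegral_smul_measure, smul_eq_mul]

theorem quasiMeasurePreserving_smul_add {r : ℝ} (hr : r ≠ 0) (c : E) :
    Measure.QuasiMeasurePreserving (fun x : E => r • x + c) μ μ :=
  ⟨(measurableEmbedding_smul_add hr c).measurable, by
    rw [map_smul_add_addHaar μ hr]; exact Measure.smul_absolutelyContinuous⟩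

end Affine

/-! ### Continuity of dilations and translations in L² -/

section DilationContinuity

variable {E W : Type*} [NormedAddCommGroup E] [NormedSpace ℝ E] [MeasurableSpace E] [BorelSpace E]
  [FiniteDimensional ℝ E] (μ : Measure E) [μ.IsAddHaarMeasure] [NormedAddCommGroup W]

/-- The Jacobian factor tends to 1, so it is eventually at most 4 = 2². The neighbourhood does not
depend on k, as the density argument requires. -/
theorem eventually_eLpNorm_comp_smul_sub_le :
    ∀ᶠ p : ℝ × E in 𝓝 (1, 0), p.1 ≠ 0 ∧ ∀ k : E → W,
      eLpNorm (fun x => k (p.1 • x - p.2)) 2 μ ≤ 2 * eLpNorm k 2 μ := by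
  have h1 : Tendsto (fun p : ℝ × E => p.1) (𝓝 (1, 0)) (𝓝 1) := continuous_fst.tendsto _
  have h2 : Tendsto (fun p : ℝ × E => ENNReal.ofReal |(p.1 ^ Module.finrank ℝ E)⁻¹|) (𝓝 (1, 0))
      (𝓝 1) := by
    have := ENNReal.tendsto_ofReal ((h1.pow (Module.finrank ℝ E)).inv₀ (by simp)).abs
    simpa using this
  filter_upwards [h1.eventually_ne one_ne_zero, h2.eventually_le_const (by norm_num : (1 : ENNReal) < 4)]
    with p hp hp'
  refine ⟨hp, fun k => ?_⟩
  rw [← ENNReal.pow_le_pow_left_iff two_ne_zero, mul_pow, eLpNorm_two_sq, eLpNorm_two_sq]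
  simp only [sub_eq_add_neg]
  rw [lintegral_comp_smul_add μ hp (-p.2) (fun x => ‖k x‖ₑ ^ 2)]
  gcongr
  exact hp'.trans (by norm_num)

theorem tendsto_eLpNorm_comp_smul_sub_of_continuous {g : E → W} (hg : Continuous g)
    (hc : HasCompactSupport g) :
    Tendsto (fun p : ℝ × E => eLpNorm (fun x => g (p.1 • x - p.2) - g x) 2 μ) (𝓝 (1, 0)) (𝓝 0) := by
  obtain ⟨C, hC⟩ := hc.exists_bound_of_continuous hg
  obtain ⟨R, hR⟩ : ∃ R, ∀ x, R < ‖x‖ → g x = 0 := by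
    obtain ⟨R, hR⟩ := hc.isCompact.isBounded.subset_closedBall 0
    exact ⟨R, fun x hx => by
      by_contra h
      have := hR (subset_tsupport g h)
      rw [mem_closedBall_zero_iff] at this
      linarith⟩
  have key : Tendsto (fun p : ℝ × E => ∫⁻ x, ‖g (p.1 • x - p.2) - g x‖ₑ ^ 2 ∂μ) (𝓝 (1, 0))
      (𝓝 (∫⁻ _, 0 ∂μ)) := by
    -- If the dilation factor exceeds 1/2, the shift is shorter than 1 and |x| > 2|R| + 2, then the
    -- transformed point still has norm above |R|, so g vanishes at it and at x.
    refine tendsto_lintegral_filter_of_dominated_convergence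
      ((closedBall (0 : E) (2 * |R| + 2)).indicator fun _ => ENNReal.ofReal (C + C) ^ 2)
      (Eventually.of_forall fun p => ?_) ?_ ?_ (ae_of_all _ fun x => ?_)
    · have : Continuous fun x => g (p.1 • x - p.2) - g x := by fun_prop
      exact (this.enorm.measurable).pow_const 2
    · have h1 : ∀ᶠ p : ℝ × E in 𝓝 (1, 0), 1 / 2 < p.1 :=
        (continuous_fst.tendsto _).eventually_const_lt (by norm_num)
      have h2 : ∀ᶠ p : ℝ × E in 𝓝 (1, 0), ‖p.2‖ < 1 := by
        have : Tendsto (fun p : ℝ × E => ‖p.2‖) (𝓝 (1, 0)) (𝓝 ‖(0 : E)‖) :=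
          (continuous_snd.norm).tendsto _
        exact this.eventually_lt_const (by simp)
      filter_upwards [h1, h2] with p hp1 hp2
      refine ae_of_all _ fun x => ?_
      by_cases hx : x ∈ closedBall (0 : E) (2 * |R| + 2)
      · rw [indicator_of_mem hx, ← ofReal_norm]
        gcongr
        exact (norm_sub_le _ _).trans (add_le_add (hC _) (hC _))
      · rw [indicator_of_notMem hx]
        have hx' : 2 * |R| + 2 < ‖x‖ := by simpa using hx
        have e1 : g x = 0 := hR x (by linarith [le_abs_self R, abs_nonneg R])
        have e2 : g (p.1 • x - p.2) = 0 := by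
          refine hR _ ?_
          have := norm_sub_norm_le (p.1 • x) p.2
          rw [norm_smul, Real.norm_of_nonneg (by linarith)] at this
          nlinarith [le_abs_self R, abs_nonneg R, norm_nonneg x]
        simp [e1, e2]
    · rw [lintegral_indicator measurableSet_closedBall, setLIntegral_const]
      exact ENNReal.mul_ne_top (by simp) measure_closedBall_lt_top.ne
    · have : Continuous fun p : ℝ × E => ‖g (p.1 • x - p.2) - g x‖ₑ ^ 2 := by fun_prop
      simpa using this.tendsto (1, 0)
  simp only [lintegral_zero, ← eLpNorm_two_sq] at key
  have := ((ENNReal.continuous_rpow_const (y := 1 / 2)).tendsto 0).comp key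
  rw [ENNReal.zero_rpow_of_pos (by norm_num)] at this
  refine this.congr fun p => ?_
  simp only [Function.comp]
  rw [← ENNReal.rpow_natCast, ← ENNReal.rpow_mul]
  norm_num

/-- Dilations and translations act continuously on `L²`. -/
theorem tendsto_eLpNorm_comp_smul_sub {h : E → W} [NormedSpace ℝ W] (hh : MemLp h 2 μ) :
    Tendsto (fun p : ℝ × E => eLpNorm (fun x => h (p.1 • x - p.2) - h x) 2 μ) (𝓝 (1, 0)) (𝓝 0) := by
  rw [ENNReal.tendsto_nhds_zero]
  intro ε hε
  -- Replacing h by g costs 2 · ε/4 in the transformed term and ε/4 in the other; the remaining ε/4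
  -- is for g itself.
  obtain ⟨g, hgc, hg, hgcont, hgL⟩ :=
    hh.exists_hasCompactSupport_eLpNorm_sub_le (by simp) (ε := ε / 4) (by simp [hε.ne'])
  have h1 := (ENNReal.tendsto_nhds_zero.1
    (tendsto_eLpNorm_comp_smul_sub_of_continuous μ hgcont hgc)) (ε / 4) (by simp [hε.ne'])
  filter_upwards [h1, eventually_eLpNorm_comp_smul_sub_le (W := W) μ] with p hp1 hp2
  obtain ⟨hp0, hp2⟩ := hp2
  have hm : AEStronglyMeasurable (fun x => h (p.1 • x - p.2)) μ := by
    simpa only [sub_eq_add_neg, Function.comp_def] using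
      hh.1.comp_quasiMeasurePreserving (quasiMeasurePreserving_smul_add μ hp0 (-p.2))
  have hmg : AEStronglyMeasurable (fun x => g (p.1 • x - p.2)) μ :=
    (by fun_prop : Continuous fun x => g (p.1 • x - p.2)).aestronglyMeasurable
  calc eLpNorm (fun x => h (p.1 • x - p.2) - h x) 2 μ
      = eLpNorm ((fun x => (h - g) (p.1 • x - p.2)) +
          ((fun x => g (p.1 • x - p.2) - g x) - (h - g))) 2 μ := by
        congr 1; ext x; simp
    _ ≤ eLpNorm (fun x => (h - g) (p.1 • x - p.2)) 2 μ +
          eLpNorm ((fun x => g (p.1 • x - p.2) - g x) - (h - g)) 2 μ :=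
        eLpNorm_add_le (hm.sub hmg) ((hmg.sub hgL.1).sub (hh.1.sub hgL.1)) one_le_two
    _ ≤ 2 * eLpNorm (h - g) 2 μ + (eLpNorm (fun x => g (p.1 • x - p.2) - g x) 2 μ
          + eLpNorm (h - g) 2 μ) :=
        add_le_add (hp2 _) (eLpNorm_sub_le (hmg.sub hgL.1) (hh.1.sub hgL.1) one_le_two)
    _ ≤ 2 * (ε / 4) + (ε / 4 + ε / 4) := by gcongr
    _ = ε := by
        rw [two_mul, ← add_assoc]
        have : (ε / 4 + ε / 4) = ε / 2 := by
          rw [← two_mul, ← mul_div_assoc, mul_comm, show (4 : ENNReal) = 2 * 2 by norm_num,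
            ENNReal.mul_div_mul_right _ _ (by norm_num) (by norm_num)]
        rw [add_assoc, this, ENNReal.add_halves]

end DilationContinuity

/-! ### Mollification combined with a dilation -/

section Mollification

open scoped Convolution

variable {N : ℕ} {𝕜 : Type*} [RCLike 𝕜]

/-- The function `x ↦ (ρ ⋆ h) (r x)`, where `ρ` is normalized. -/
noncomputable def dilatedMollification (ρ : ContDiffBump (0 : EuclideanSpace ℝ (Fin N))) (r : ℝ)
    (h : EuclideanSpace ℝ (Fin N) → 𝕜) (x : EuclideanSpace ℝ (Fin N)) : 𝕜 :=
  (ρ.normed volume ⋆[ContinuousLinearMap.lsmul ℝ ℝ, volume] h : EuclideanSpace ℝ (Fin N) → 𝕜) (r • x)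

variable (ρ : ContDiffBump (0 : EuclideanSpace ℝ (Fin N))) (r : ℝ)
  {h g : EuclideanSpace ℝ (Fin N) → 𝕜}

theorem contDiff_dilatedMollification (hh : LocallyIntegrable h) :
    ContDiff ℝ ∞ (dilatedMollification ρ r h) :=
  (ρ.hasCompactSupport_normed.contDiff_convolution_left _ ρ.contDiff_normed hh).comp
    (contDiff_const_smul r)

/-- The derivative falls on the kernel, and the chain rule contributes r. Only the weak derivative
identity for this one shifted kernel is assumed, so the lemma serves both for kernels supported in
the ball and for extensions by zero. -/
theorem partialDeriv_dilatedMollification (hh : LocallyIntegrable h) (i : Fin N)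
    (x : EuclideanSpace ℝ (Fin N))
    (hw : ∫ s, partialDeriv i (fun s => ρ.normed volume (r • x - s)) s • h s =
      - ∫ s, ρ.normed volume (r • x - s) • g s) :
    partialDeriv i (dilatedMollification ρ r h) x = r • dilatedMollification ρ r g x := by
  have hρ : ContDiff ℝ 1 (ρ.normed (volume : Measure (EuclideanSpace ℝ (Fin N)))) :=
    ρ.contDiff_normed
  have hρc : HasCompactSupport (ρ.normed (volume : Measure (EuclideanSpace ℝ (Fin N)))) :=
    ρ.hasCompactSupport_normed
  have h1 := hρc.hasFDerivAt_convolution_left (ContinuousLinearMap.lsmul ℝ ℝ) hρ hh (r • x)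
  have h2 : HasFDerivAt (fun x : EuclideanSpace ℝ (Fin N) => r • x)
      (r • ContinuousLinearMap.id ℝ (EuclideanSpace ℝ (Fin N))) x :=
    (hasFDerivAt_id x).const_smul r
  have h3 := h1.comp x h2
  have h4 : ∀ s, partialDeriv i (fun s => ρ.normed volume (r • x - s)) s =
      - partialDeriv i (ρ.normed volume) (r • x - s) := by
    intro s
    have h5 : HasFDerivAt (fun s : EuclideanSpace ℝ (Fin N) => r • x - s)
      (-ContinuousLinearMap.id ℝ (EuclideanSpace ℝ (Fin N))) s := (hasFDerivAt_id s).const_sub _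
    have h6 := ((hρ.differentiable one_ne_zero (r • x - s)).hasFDerivAt.comp s h5).fderiv
    rw [Function.comp_def] at h6
    simp only [partialDeriv, h6]
    simp
  simp only [h4, neg_smul, integral_neg, neg_inj] at hw
  rw [partialDeriv, show dilatedMollification ρ r h = (ρ.normed volume
    ⋆[ContinuousLinearMap.lsmul ℝ ℝ, volume] h : EuclideanSpace ℝ (Fin N) → 𝕜) ∘ (fun x => r • x)
    from rfl, h3.fderiv, dilatedMollification, convolution_lsmul_swap, ← hw]
  simp only [ContinuousLinearMap.comp_apply, smul_apply,
    ContinuousLinearMap.id_apply, map_smul]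
  congr 1
  have hex := (hρc.fderiv ℝ).convolutionExists_left
    ((ContinuousLinearMap.lsmul ℝ ℝ : ℝ →L[ℝ] 𝕜 →L[ℝ] 𝕜).precompL (EuclideanSpace ℝ (Fin N)))
    (hρ.continuous_fderiv one_ne_zero) hh (r • x)
  rw [convolution_eq_swap, ContinuousLinearMap.integral_apply hex.integrable_swap]
  rfl

theorem enorm_integral_sq_le {α W : Type*} [MeasurableSpace α] {ν : Measure α}
    [IsProbabilityMeasure ν] [NormedAddCommGroup W] [NormedSpace ℝ W] {w : α → W}
    (hw : AEStronglyMeasurable w ν) : ‖∫ t, w t ∂ν‖ₑ ^ 2 ≤ ∫⁻ t, ‖w t‖ₑ ^ 2 ∂ν := by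
  rw [← eLpNorm_two_sq]
  gcongr
  refine (enorm_integral_le_lintegral_enorm _).trans ?_
  rw [← eLpNorm_one_eq_lintegral_enorm]
  exact eLpNorm_le_eLpNorm_of_exponent_le one_le_two hw

/-- The difference is an average of h(rx - t) - h(x) over t against the probability measure with
density ρ; Jensen and Tonelli bound its norm by the largest norm of these differences. -/
theorem eLpNorm_dilatedMollification_sub_le (hr : r ≠ 0) (hh : MemLp h 2)
    (c : ENNReal) (hc : ∀ t : EuclideanSpace ℝ (Fin N), ‖t‖ < ρ.rOut →
      eLpNorm (fun x => h (r • x - t) - h x) 2 ≤ c) :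
    eLpNorm (fun x => dilatedMollification ρ r h x - h x) 2 ≤ c := by
  set ρ' := ρ.normed (volume : Measure (EuclideanSpace ℝ (Fin N)))
  have hρc : Continuous ρ' := ρ.continuous_normed
  have hρ0 : ∀ x, 0 ≤ ρ' x := ρ.nonneg_normed
  set ν : Measure (EuclideanSpace ℝ (Fin N)) := volume.withDensity fun t => (ρ' t).toNNReal
  have hν : IsProbabilityMeasure ν := ⟨by
    rw [withDensity_apply _ MeasurableSet.univ, setLIntegral_univ]
    have := ofReal_integral_eq_lintegral_ofReal (ρ.integrable_normed (μ := volume))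
      (ae_of_all _ hρ0)
    rw [ρ.integral_normed, ENNReal.ofReal_one] at this
    exact this.symm⟩
  have hac : ν ≪ volume := withDensity_absolutelyContinuous _ _
  have hLI : LocallyIntegrable h := hh.locallyIntegrable one_le_two
  have hmeas : Measurable fun t => (ρ' t).toNNReal := hρc.measurable.real_toNNReal
  have hint : ∀ y, Integrable (fun t => h (y - t)) ν := by
    intro y
    rw [integrable_withDensity_iff_integrable_smul hmeas]
    refine (ρ.hasCompactSupport_normed.convolutionExists_left
      (ContinuousLinearMap.lsmul ℝ ℝ) hρc hLI y).congr (ae_of_all _ fun t => ?_)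
    simp [NNReal.smul_def, hρ0, ρ']
  have hmol : ∀ x, dilatedMollification ρ r h x - h x = ∫ t, (h (r • x - t) - h x) ∂ν := by
    intro x
    rw [integral_sub (hint _) (integrable_const _), integral_const, probReal_univ, one_smul,
      integral_withDensity_eq_integral_smul hmeas, dilatedMollification, convolution_lsmul]
    simp [NNReal.smul_def, hρ0, ρ']
  -- Tonelli needs joint measurability although h is only almost everywhere measurable; each section
  -- in x is an invertible affine map.
  have hq : Measure.QuasiMeasurePreserving
      (fun p : EuclideanSpace ℝ (Fin N) × EuclideanSpace ℝ (Fin N) => r • p.1 - p.2)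
      (volume.prod ν) volume := by
    refine (QuasiMeasurePreserving.prod_of_left (by fun_prop) (ae_of_all _ fun t => ?_))
    simpa only [sub_eq_add_neg] using quasiMeasurePreserving_smul_add volume hr (-t)
  have hjm : AEStronglyMeasurable
      (fun p : EuclideanSpace ℝ (Fin N) × EuclideanSpace ℝ (Fin N) => h (r • p.1 - p.2) - h p.1)
      (volume.prod ν) :=
    (hh.1.comp_quasiMeasurePreserving hq).sub hh.1.comp_fst
  rw [← ENNReal.pow_le_pow_left_iff two_ne_zero, eLpNorm_two_sq]
  calc ∫⁻ x, ‖dilatedMollification ρ r h x - h x‖ₑ ^ 2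
      ≤ ∫⁻ x, ∫⁻ t, ‖h (r • x - t) - h x‖ₑ ^ 2 ∂ν := by
        refine lintegral_mono fun x => ?_
        rw [hmol]
        exact enorm_integral_sq_le ((hint _).sub (integrable_const _)).1
    _ = ∫⁻ t, (∫⁻ x, ‖h (r • x - t) - h x‖ₑ ^ 2) ∂ν :=
        lintegral_lintegral_swap (hjm.enorm.pow_const 2)
    _ ≤ ∫⁻ t, c ^ 2 ∂ν := by
        refine lintegral_mono_ae ?_
        have : ∀ᵐ t ∂ν, t ∈ ball (0 : EuclideanSpace ℝ (Fin N)) ρ.rOut := by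
          rw [ae_withDensity_iff hmeas.coe_nnreal_ennreal]
          refine ae_of_all _ fun t ht => ?_
          rw [← ρ.support_normed_eq (μ := volume)]
          exact fun h0 => ht (by simp [ρ', h0])
        filter_upwards [this] with t ht
        rw [← eLpNorm_two_sq]
        gcongr
        exact hc t (by simpa using ht)
    _ = c ^ 2 := by simp

end Mollification

/-! ### Density of smooth functions and the characterisation of H¹₀ -/

section Approximation

variable {N : ℕ} {𝕜 : Type*} [RCLike 𝕜]

theorem tendsto_eLpNorm_dilatedMollification_sub
    {ρ : ℕ → ContDiffBump (0 : EuclideanSpace ℝ (Fin N))} {r : ℕ → ℝ}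
    (hρ : Tendsto (fun n => (ρ n).rOut) atTop (𝓝 0)) (hr : Tendsto r atTop (𝓝 1))
    (hr0 : ∀ n, r n ≠ 0) {h : EuclideanSpace ℝ (Fin N) → 𝕜} (hh : MemLp h 2) :
    Tendsto (fun n => eLpNorm (fun x => dilatedMollification (ρ n) (r n) h x - h x) 2 volume)
      atTop (𝓝 0) := by
  rw [ENNReal.tendsto_nhds_zero]
  intro c hc
  have h1 := ENNReal.tendsto_nhds_zero.1 (tendsto_eLpNorm_comp_smul_sub volume hh) c hc
  rw [nhds_prod_eq] at h1
  obtain ⟨p, hp, q, hq, hpq⟩ := eventually_prod_iff.1 h1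
  obtain ⟨δ, hδ, hq⟩ := Metric.eventually_nhds_iff.1 hq
  filter_upwards [hr.eventually hp, hρ.eventually_le_const hδ] with n hn hn'
  exact eLpNorm_dilatedMollification_sub_le (ρ n) (r n) (hr0 n) hh c fun t ht =>
    hpq hn (hq (by simpa using ht.trans_le hn'))

theorem isTestFunction_normed_sub (ρ : ContDiffBump (0 : EuclideanSpace ℝ (Fin N)))
    {y : EuclideanSpace ℝ (Fin N)} {U : Set (EuclideanSpace ℝ (Fin N))}
    (hU : closedBall y ρ.rOut ⊆ U) :
    IsTestFunction U fun s => ρ.normed volume (y - s) := by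
  have hsupp : tsupport (fun s => ρ.normed volume (y - s)) ⊆ closedBall y ρ.rOut := by
    refine closure_minimal (fun s hs => ?_) isClosed_closedBall
    have : y - s ∈ ball 0 ρ.rOut := by
      rw [← ρ.support_normed_eq (μ := volume)]
      exact hs
    rw [mem_ball_zero_iff, ← dist_eq_norm, dist_comm] at this
    exact this.le
  exact ⟨ρ.contDiff_normed.comp (contDiff_const.sub contDiff_id),
    (isCompact_closedBall _ _).of_isClosed_subset (isClosed_tsupport _) hsupp, hsupp.trans hU⟩

theorem integral_smul_indicator {α : Type*} [MeasurableSpace α] {μ : Measure α} {s : Set α}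
    (hs : MeasurableSet s) (φ : α → ℝ) (g : α → 𝕜) :
    ∫ x, φ x • s.indicator g x ∂μ = ∫ x in s, φ x • g x ∂μ := by
  rw [← integral_indicator hs]
  simp only [← indicator_smul_apply]

/-- Dilated mollifications converge in `H¹` of the unit ball, provided that the weak derivatives
may be tested against the dilated mollifiers. -/
theorem tendsto_dilatedMollification_of_integral_eq
    {ρ : ℕ → ContDiffBump (0 : EuclideanSpace ℝ (Fin N))} {r : ℕ → ℝ}
    (hρ : Tendsto (fun n => (ρ n).rOut) atTop (𝓝 0)) (hr : Tendsto r atTop (𝓝 1))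
    (hr0 : ∀ n, r n ≠ 0) {f : EuclideanSpace ℝ (Fin N) → 𝕜}
    {G : Fin N → EuclideanSpace ℝ (Fin N) → 𝕜} (hG : HasH1Gradient (ball 0 1) f G)
    (hw : ∀ n, ∀ x ∈ ball (0 : EuclideanSpace ℝ (Fin N)) 1, ∀ i,
      ∫ s in ball 0 1, partialDeriv i (fun s => (ρ n).normed volume (r n • x - s)) s • f s =
      - ∫ s in ball 0 1, (ρ n).normed volume (r n • x - s) • G i s) :
    (∀ n, ContDiff ℝ ∞ (dilatedMollification (ρ n) (r n) ((ball 0 1).indicator f))) ∧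
    Tendsto (fun n => eLpNorm (fun x => dilatedMollification (ρ n) (r n) ((ball 0 1).indicator f) x
      - f x) 2 (volume.restrict (ball 0 1))) atTop (𝓝 0) ∧
    ∀ i, Tendsto (fun n => eLpNorm (fun x => partialDeriv i
      (dilatedMollification (ρ n) (r n) ((ball 0 1).indicator f)) x - G i x) 2
      (volume.restrict (ball 0 1))) atTop (𝓝 0) := by
  have hmb : MeasurableSet (ball (0 : EuclideanSpace ℝ (Fin N)) 1) := measurableSet_ball
  have hf : MemLp ((ball 0 1).indicator f) 2 := (memLp_indicator_iff_restrict hmb).2 hG.memLp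
  have hg : ∀ i, MemLp ((ball 0 1).indicator (G i)) 2 := fun i =>
    (memLp_indicator_iff_restrict hmb).2 (hG.memLp_grad i)
  have hloc : LocallyIntegrable ((ball 0 1).indicator f) := hf.locallyIntegrable one_le_two
  have hcont := fun n => contDiff_dilatedMollification (ρ n) (r n) hloc
  have hrestr : ∀ (h : EuclideanSpace ℝ (Fin N) → 𝕜), MemLp ((ball 0 1).indicator h) 2 →
      Tendsto (fun n => eLpNorm (fun x => dilatedMollification (ρ n) (r n)
        ((ball 0 1).indicator h) x - h x) 2 (volume.restrict (ball 0 1))) atTop (𝓝 0) := by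
    intro h hh
    refine tendsto_of_tendsto_of_tendsto_of_le_of_le tendsto_const_nhds
      (tendsto_eLpNorm_dilatedMollification_sub hρ hr hr0 hh) (fun _ => zero_le) fun n => ?_
    refine le_trans (le_of_eq (eLpNorm_congr_ae ?_)) (eLpNorm_mono_measure _ Measure.restrict_le_self)
    filter_upwards [ae_restrict_mem hmb] with x hx
    rw [indicator_of_mem hx]
  refine ⟨hcont, hrestr f hf, fun i => ?_⟩
  -- With g* the dilated mollification of g = G i, the derivative error is r g* - g = r (g* - g) +
  -- (r - 1) g.
  have hb : Tendsto (fun n => ‖r n‖ₑ * eLpNorm (fun x => dilatedMollification (ρ n) (r n)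
      ((ball 0 1).indicator (G i)) x - G i x) 2 (volume.restrict (ball 0 1)) +
      ‖r n - 1‖ₑ * eLpNorm (G i) 2 (volume.restrict (ball 0 1))) atTop (𝓝 0) := by
    have e1 := ENNReal.Tendsto.mul hr.enorm (Or.inr ENNReal.zero_ne_top)
      (hrestr (G i) (hg i)) (Or.inr (by simp))
    have e2 := ENNReal.Tendsto.mul_const (hr.sub_const 1).enorm
      (Or.inr (hG.memLp_grad i).eLpNorm_ne_top)
    simpa using e1.add e2
  refine tendsto_of_tendsto_of_tendsto_of_le_of_le tendsto_const_nhds hb (fun _ => zero_le)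
    fun n => ?_
  have hc : Continuous (dilatedMollification (ρ n) (r n) ((ball 0 1).indicator (G i))) :=
    (contDiff_dilatedMollification (ρ n) (r n) ((hg i).locallyIntegrable one_le_two)).continuous
  have hm : AEStronglyMeasurable (fun x => dilatedMollification (ρ n) (r n)
      ((ball 0 1).indicator (G i)) x - G i x) (volume.restrict (ball 0 1)) :=
    hc.aestronglyMeasurable.sub (hG.memLp_grad i).1
  calc _ = eLpNorm (r n • (fun x => dilatedMollification (ρ n) (r n)
      ((ball 0 1).indicator (G i)) x - G i x) + (r n - 1) • G i) 2
        (volume.restrict (ball 0 1)) := by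
        refine eLpNorm_congr_ae ?_
        filter_upwards [ae_restrict_mem hmb] with x hx
        rw [partialDeriv_dilatedMollification (g := (ball 0 1).indicator (G i)) _ _ hloc]
        · simp only [Pi.add_apply, Pi.smul_apply, smul_sub, sub_smul, one_smul, Pi.sub_apply]
          abel
        · rw [integral_smul_indicator hmb, integral_smul_indicator hmb, hw n x hx i]
    _ ≤ _ := eLpNorm_add_le (hm.const_smul _) ((hG.memLp_grad i).1.const_smul _) one_le_two
    _ = _ := by rw [eLpNorm_const_smul, eLpNorm_const_smul]

theorem tendsto_inv_natCast_add_two : Tendsto (fun n : ℕ => ((n : ℝ) + 2)⁻¹) atTop (𝓝 0) :=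
  tendsto_inv_atTop_zero.comp (tendsto_atTop_add_const_right _ _ tendsto_natCast_atTop_atTop)

/-- A bump function whose outer radius is `1 / (n + 2)`. -/
noncomputable def smallBump (N n : ℕ) : ContDiffBump (0 : EuclideanSpace ℝ (Fin N)) :=
  ⟨((n : ℝ) + 2)⁻¹ / 2, ((n : ℝ) + 2)⁻¹, by positivity, half_lt_self (by positivity)⟩

/-- Functions which are smooth up to the boundary are dense in `H¹` of the unit ball. -/
theorem HasH1Gradient.exists_contDiff_tendsto {f : EuclideanSpace ℝ (Fin N) → 𝕜}
    {G : Fin N → EuclideanSpace ℝ (Fin N) → 𝕜} (hG : HasH1Gradient (ball 0 1) f G) :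
    ∃ u : ℕ → EuclideanSpace ℝ (Fin N) → 𝕜, (∀ n, ContDiff ℝ 1 (u n)) ∧
      Tendsto (fun n => eLpNorm (fun x => u n x - f x) 2 (volume.restrict (ball 0 1)))
        atTop (𝓝 0) ∧
      ∀ i, Tendsto (fun n => eLpNorm (fun x => partialDeriv i (u n) x - G i x) 2
        (volume.restrict (ball 0 1))) atTop (𝓝 0) := by
  have hpos : ∀ n : ℕ, 0 < 1 - ((n : ℝ) + 2)⁻¹ := fun n => by
    have : ((n : ℝ) + 2)⁻¹ < 1 := inv_lt_one_of_one_lt₀ (by linarith [n.cast_nonneg (α := ℝ)])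
    linarith
  -- With δ the bump radius, the contraction by 1 - δ leaves just enough room: |s| ≤ δ + (1 - δ)|x|
  -- < 1.
  have hsub : ∀ (n : ℕ), ∀ x ∈ ball (0 : EuclideanSpace ℝ (Fin N)) 1,
      closedBall ((1 - ((n : ℝ) + 2)⁻¹) • x) (smallBump N n).rOut ⊆ ball 0 1 := by
    intro n x hx s hs
    have hx' : ‖x‖ < 1 := by simpa using hx
    have hs' : ‖s - (1 - ((n : ℝ) + 2)⁻¹) • x‖ ≤ ((n : ℝ) + 2)⁻¹ := by
      rw [← dist_eq_norm]; exact hs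
    have := norm_le_norm_sub_add s ((1 - ((n : ℝ) + 2)⁻¹) • x)
    rw [norm_smul, Real.norm_of_nonneg (hpos n).le] at this
    rw [mem_ball_zero_iff]
    nlinarith [hpos n]
  obtain ⟨h1, h2, h3⟩ := tendsto_dilatedMollification_of_integral_eq
    (ρ := smallBump N) (r := fun n => 1 - ((n : ℝ) + 2)⁻¹) tendsto_inv_natCast_add_two
    (by simpa using tendsto_inv_natCast_add_two.const_sub 1) (fun n => (hpos n).ne') hG
    fun n x hx i => hG.integral_eq i _ (isTestFunction_normed_sub _ (hsub n x hx))
  exact ⟨_, fun n => (h1 n).of_le (by exact_mod_cast le_top), h2, h3⟩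

/-- If extension by zero preserves the weak derivatives, then the function is in `H¹₀`. -/
theorem HasH1Gradient.memH10_of_integral_eq {f : EuclideanSpace ℝ (Fin N) → 𝕜}
    {G : Fin N → EuclideanSpace ℝ (Fin N) → 𝕜} (hG : HasH1Gradient (ball 0 1) f G)
    (hw : ∀ i, ∀ ψ : EuclideanSpace ℝ (Fin N) → ℝ, IsTestFunction univ ψ →
      ∫ x in ball 0 1, partialDeriv i ψ x • f x = - ∫ x in ball 0 1, ψ x • G i x) :
    MemH10 (ball 0 1) f := by
  have hpos : ∀ n : ℕ, 0 < ((n : ℝ) + 2)⁻¹ := fun n => by positivity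
  obtain ⟨h1, h2, h3⟩ := tendsto_dilatedMollification_of_integral_eq
    (ρ := smallBump N) (r := fun n => 1 + 2 * ((n : ℝ) + 2)⁻¹) tendsto_inv_natCast_add_two
    (by simpa using (tendsto_inv_natCast_add_two.const_mul 2).const_add 1)
    (fun n => by have := hpos n; positivity) hG
    fun n x hx i => hw i _ (isTestFunction_normed_sub _ (subset_univ _))
  refine ⟨_, fun n => ?_, G, hG, h2, h3⟩
  set δ := ((n : ℝ) + 2)⁻¹ with hδ
  have hδ0 : 0 < δ := hpos n
  -- Mollifying enlarges the support radius to 1 + δ, and the dilation divides it by 1 + 2δ, so it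
  -- ends below 1.
  have hsupp : tsupport (dilatedMollification (smallBump N n) (1 + 2 * δ) ((ball 0 1).indicator f))
      ⊆ closedBall 0 ((1 + δ) / (1 + 2 * δ)) := by
    refine closure_minimal (fun x hx => ?_) isClosed_closedBall
    by_contra hx'
    refine hx ?_
    rw [dilatedMollification, convolution_lsmul]
    refine integral_eq_zero_of_ae (ae_of_all _ fun t => ?_)
    by_cases ht : t ∈ ball (0 : EuclideanSpace ℝ (Fin N)) δ
    · have ht' : ‖t‖ < δ := by simpa using ht
      have hx2 : (1 + δ) / (1 + 2 * δ) < ‖x‖ := by simpa using hx'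
      rw [div_lt_iff₀ (by positivity)] at hx2
      have h4 : (1 + 2 * δ) • x - t ∉ ball (0 : EuclideanSpace ℝ (Fin N)) 1 := by
        have := norm_sub_norm_le ((1 + 2 * δ) • x) t
        rw [norm_smul, Real.norm_of_nonneg (by positivity)] at this
        rw [mem_ball_zero_iff, not_lt]
        linarith
      simp [indicator_of_notMem h4]
    · have : (smallBump N n).normed volume t = 0 := by
        rw [← Function.notMem_support, (smallBump N n).support_normed_eq]
        exact ht
      simp [this]
  refine ⟨h1 n, (isCompact_closedBall _ _).of_isClosed_subset (isClosed_tsupport _) hsupp,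
    hsupp.trans (closedBall_subset_ball ?_)⟩
  rw [div_lt_one (by positivity)]
  linarith

theorem HasH1Gradient.integral_eq_of_boundaryFunctional_eq_zero
    {f : EuclideanSpace ℝ (Fin N) → 𝕜}
    {G : Fin N → EuclideanSpace ℝ (Fin N) → 𝕜} (hG : HasH1Gradient (ball 0 1) f G) {i : Fin N}
    {ψ : EuclideanSpace ℝ (Fin N) → ℝ} (hψ : ContDiff ℝ 1 ψ)
    (h : boundaryFunctional i f (G i) ψ = 0) :
    ∫ x in ball 0 1, partialDeriv i ψ x • f x = - ∫ x in ball 0 1, ψ x • G i x := by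
  rw [boundaryFunctional, integral_add
    (MemLp.integrable_smul_two ((hψ.continuous_partialDeriv i).memLp_restrict_ball 2 0 1) hG.memLp)
    (MemLp.integrable_smul_two (hψ.continuous.memLp_restrict_ball 2 0 1) (hG.memLp_grad i))] at h
  exact eq_neg_of_add_eq_zero_left h

/-- Functions in `H¹₀` have trace zero. -/
theorem MemH10.hasTrace_zero {f : EuclideanSpace ℝ (Fin N) → 𝕜} (hf : MemH10 (ball 0 1) f) :
    HasTrace f 0 := by
  obtain ⟨u, hu, h⟩ := hf
  refine ⟨MemLp.zero, u, fun n => (hu n).1.of_le (by exact_mod_cast le_top), h, ?_⟩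
  have : ∀ n, (fun z : sphere (0 : EuclideanSpace ℝ (Fin N)) 1 =>
      u n z - (0 : sphere (0 : EuclideanSpace ℝ (Fin N)) 1 → 𝕜) z) = 0 := by
    intro n
    ext z
    have hz : (z : EuclideanSpace ℝ (Fin N)) ∉ tsupport (u n) := fun hz => by
      have := (hu n).2.2 hz
      simp at this
    simp [image_eq_zero_of_notMem_tsupport hz]
  simp only [this]
  simp

end Approximation

/-! ### Touching balls and accumulation of balls in Ω -/

section Geometry

variable {N : ℕ}

theorem span_singleton_ne_top_of_two_le (hN : 2 ≤ N) (z : EuclideanSpace ℝ (Fin N)) :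
    Submodule.span ℝ {z} ≠ ⊤ := by
  intro h
  have h1 := finrank_span_le_card (R := ℝ) ({z} : Set (EuclideanSpace ℝ (Fin N)))
  rw [Set.toFinset_singleton, Finset.card_singleton, h, finrank_top, finrank_euclideanSpace, Fintype.card_fin] at h1
  omega

/-- The cone over one point lies in a line, which is Lebesgue null when N ≥ 2. -/
theorem toSphere_singleton (hN : 2 ≤ N) (z : sphere (0 : EuclideanSpace ℝ (Fin N)) 1) :
    (volume : Measure (EuclideanSpace ℝ (Fin N))).toSphere {z} = 0 := by
  rw [Measure.toSphere_apply' _ (measurableSet_singleton z)]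
  refine mul_eq_zero_of_right _ (measure_mono_null ?_ (Measure.addHaar_submodule volume
    (Submodule.span ℝ {(z : EuclideanSpace ℝ (Fin N))}) (span_singleton_ne_top_of_two_le hN _)))
  rintro _ ⟨t, -, w, hw, rfl⟩
  simp only [image_singleton, mem_singleton_iff] at hw
  subst hw
  exact Submodule.smul_mem _ _ (Submodule.mem_span_singleton_self _)

variable {E : Type*} [NormedAddCommGroup E] [InnerProductSpace ℝ E]

/-- Equality in the triangle inequality makes a and b antiparallel: ‖b‖ a + ‖a‖ b = 0. For two
disjoint balls touching at a point, this says that they share the tangent hyperplane there. -/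
theorem inner_eq_zero_of_norm_add_norm_le {a b v : E} (ha : a ≠ 0) (hab : ‖a‖ + ‖b‖ ≤ ‖a - b‖)
    (hv : inner ℝ a v = 0) : inner ℝ b v = 0 := by
  have h1 := norm_sub_sq_real a b
  have h2 : inner ℝ a b ≤ -(‖a‖ * ‖b‖) := by
    nlinarith [norm_nonneg a, norm_nonneg b, norm_nonneg (a - b)]
  have h3 : ‖b‖ • a + ‖a‖ • b = 0 := by
    rw [← norm_eq_zero, ← sq_eq_zero_iff]
    refine le_antisymm ?_ (sq_nonneg _)
    rw [norm_add_sq_real, inner_smul_left, inner_smul_right, norm_smul, norm_smul, norm_norm,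
      norm_norm]
    simp only [conj_trivial]
    nlinarith [mul_nonneg (norm_nonneg a) (norm_nonneg b)]
  have h4 := congrArg (fun w => inner ℝ w v) h3
  simp only [inner_add_left, inner_smul_left, conj_trivial, hv, mul_zero, zero_add,
    inner_zero_left, mul_eq_zero, norm_eq_zero, ha, false_or] at h4
  exact h4

/-- A ball touches a disjoint ball in at most one point. -/
theorem eq_of_mem_closedBall_of_disjoint {c d : E} {r s : ℝ} (hr : 0 < r) (hs : 0 < s)
    (h : Disjoint (ball c r) (ball d s)) {z : E} (hz : ‖z‖ = 1) (hzd : r • z + c ∈ closedBall d s) :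
    z = ‖d - c‖⁻¹ • (d - c) := by
  rw [disjoint_ball_ball_iff hr hs, dist_comm, dist_eq_norm] at h
  set w := d - c
  have hw : 0 < ‖w‖ := by linarith
  have h1 : ‖r • z - w‖ ≤ s := by
    rw [mem_closedBall, dist_eq_norm] at hzd
    rwa [show r • z - w = r • z + c - d by simp only [w]; abel]
  have h2 := norm_sub_sq_real (r • z) w
  rw [inner_smul_left, norm_smul, hz, Real.norm_of_nonneg hr.le] at h2
  simp only [conj_trivial] at h2
  -- Since |rz - w| ≤ s ≤ |w| - r, the expanded square forces equality in Cauchy–Schwarz, so z is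
  -- the unit vector along w.
  have h3 : ‖w‖ ≤ inner ℝ z w := by
    have : ‖r • z - w‖ ^ 2 ≤ (‖w‖ - r) ^ 2 :=
      pow_le_pow_left₀ (norm_nonneg _) (by linarith) 2
    have h5 : r * ‖w‖ ≤ r * inner ℝ z w := by nlinarith
    exact le_of_mul_le_mul_left h5 hr
  rw [← sub_eq_zero, ← norm_eq_zero, ← sq_eq_zero_iff]
  refine le_antisymm ?_ (sq_nonneg _)
  rw [norm_sub_sq_real, inner_smul_right, norm_smul, hz, norm_inv, norm_norm,
    inv_mul_cancel₀ hw.ne']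
  have : 1 ≤ ‖w‖⁻¹ * inner ℝ z w := by
    rw [← inv_mul_cancel₀ hw.ne']
    gcongr
  linarith

/-- Pythagoras: a tangential displacement leaves the closed ball around a whose sphere passes
through the origin. -/
theorem lt_norm_add_smul {a v : E} (hv : v ≠ 0) (h : inner ℝ a v = 0) {t : ℝ} (ht : t ≠ 0) :
    ‖a‖ < ‖t • v - a‖ := by
  rw [← sq_lt_sq₀ (norm_nonneg _) (norm_nonneg _), norm_sub_sq_real, inner_smul_left,
    real_inner_comm, h]
  have : 0 < ‖t • v‖ := norm_pos_iff.2 (smul_ne_zero ht hv)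
  simp only [mul_zero, sub_zero]
  nlinarith

theorem exists_ne_zero_inner_eq_zero (hN : 2 ≤ N) (a : EuclideanSpace ℝ (Fin N)) :
    ∃ v : EuclideanSpace ℝ (Fin N), v ≠ 0 ∧ inner ℝ a v = 0 := by
  have h : (Submodule.span ℝ {a})ᗮ ≠ ⊥ := fun h =>
    span_singleton_ne_top_of_two_le hN a (Submodule.orthogonal_eq_bot_iff.1 h)
  obtain ⟨v, hv, hv0⟩ := Submodule.exists_mem_ne_zero_of_ne_bot h
  exact ⟨v, hv0, Submodule.mem_orthogonal_singleton_iff_inner_right.1 hv⟩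

/-- Finitely many disjoint open balls whose closures cover a neighbourhood of a point
contain this point. -/
theorem mem_iUnion_ball_of_mem_nhds (hN : 2 ≤ N) {ι : Type*} {S : Set ι} (hS : S.Finite)
    {y : ι → EuclideanSpace ℝ (Fin N)} {ε : ι → ℝ} (hε : ∀ p, 0 < ε p)
    (hdisj : Pairwise fun p q => Disjoint (ball (y p) (ε p)) (ball (y q) (ε q)))
    {x : EuclideanSpace ℝ (Fin N)} (hx : (⋃ p ∈ S, closedBall (y p) (ε p)) ∈ 𝓝 x) :
    ∃ p, x ∈ ball (y p) (ε p) := by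
  by_contra! hout
  obtain ⟨p, hpS, hp⟩ := mem_iUnion₂.1 (mem_of_mem_nhds hx)
  have hnorm : ∀ q, x ∈ closedBall (y q) (ε q) → ‖y q - x‖ = ε q := by
    intro q hq
    have h1 := hout q
    rw [mem_ball, not_lt, dist_comm, dist_eq_norm] at h1
    rw [mem_closedBall, dist_comm, dist_eq_norm] at hq
    exact le_antisymm hq h1
  -- All closed balls through x touch there and share a tangent hyperplane, nontrivial since N ≥ 2.
  -- A small move along v leaves each of them and does not reach the finitely many others, against
  -- the covering.
  obtain ⟨v, hv0, hv⟩ := exists_ne_zero_inner_eq_zero hN (y p - x)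
  have hinner : ∀ q, x ∈ closedBall (y q) (ε q) → inner ℝ (y q - x) v = 0 := by
    intro q hq
    rcases eq_or_ne p q with rfl | hpq
    · exact hv
    · refine inner_eq_zero_of_norm_add_norm_le (a := y p - x) ?_ ?_ hv
      · rw [← norm_ne_zero_iff, hnorm p hp]
        exact (hε p).ne'
      · rw [hnorm p hp, hnorm q hq, sub_sub_sub_cancel_right, ← dist_eq_norm]
        exact (disjoint_ball_ball_iff (hε p) (hε q)).1 (hdisj hpq)
  have htend : Tendsto (fun t : ℝ => x + t • v) (𝓝[≠] 0) (𝓝 x) := by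
    have : Continuous fun t : ℝ => x + t • v := by fun_prop
    simpa using (this.tendsto 0).mono_left nhdsWithin_le_nhds
  have hev : ∀ q ∈ S, ∀ᶠ t : ℝ in 𝓝[≠] 0, x + t • v ∉ closedBall (y q) (ε q) := by
    intro q _
    by_cases hq : x ∈ closedBall (y q) (ε q)
    · filter_upwards [self_mem_nhdsWithin] with t ht hmem
      have := lt_norm_add_smul hv0 (hinner q hq) ht
      rw [hnorm q hq] at this
      rw [mem_closedBall, dist_eq_norm] at hmem
      refine absurd hmem (not_le.2 ?_)
      rwa [show x + t • v - y q = t • v - (y q - x) by abel]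
    · exact htend.eventually (isClosed_closedBall.isOpen_compl.mem_nhds hq)
  obtain ⟨t, ht1, ht2⟩ := (((hS.eventually_all).2 hev).and (htend.eventually hx)).exists
  obtain ⟨q, hqS, hq⟩ := mem_iUnion₂.1 ht2
  exact ht1 q hqS hq

variable {Ω : Set (EuclideanSpace ℝ (Fin N))} {y : ℕ → EuclideanSpace ℝ (Fin N)} {ε : ℕ → ℝ}

theorem volume_ball_eq_ofReal_pow_mul {r : ℝ} (hr : 0 < r) (x : EuclideanSpace ℝ (Fin N)) :
    volume (ball x r) =
      ENNReal.ofReal (r ^ N) * volume (ball (0 : EuclideanSpace ℝ (Fin N)) 1) := by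
  rw [Measure.addHaar_ball_of_pos volume x hr, finrank_euclideanSpace, Fintype.card_fin]

/-- The volumes of the disjoint balls add up to that of Ω. -/
theorem summable_pow_of_disjoint_balls (hΩfin : volume Ω ≠ ⊤) (hε : ∀ p, 0 < ε p)
    (hdisj : Pairwise fun p q => Disjoint (ball (y p) (ε p)) (ball (y q) (ε q)))
    (hcover : Ω =ᵐ[volume] ⋃ p, ball (y p) (ε p)) : Summable fun p => ε p ^ N := by
  rw [measure_congr hcover, measure_iUnion hdisj fun _ => measurableSet_ball] at hΩfin
  simp only [fun p => volume_ball_eq_ofReal_pow_mul (hε p) (y p)] at hΩfin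
  rw [ENNReal.tsum_mul_right] at hΩfin
  have h1 : ∑' p, ENNReal.ofReal (ε p ^ N) ≠ ⊤ := fun h => hΩfin (by
    rw [h, ENNReal.top_mul (measure_ball_pos volume _ one_pos).ne'])
  have := ENNReal.summable_toReal h1
  refine this.congr fun p => ?_
  exact ENNReal.toReal_ofReal (pow_nonneg (hε p).le N)

theorem eventually_cofinite_lt_of_summable_pow (hs : Summable fun p => ε p ^ N) {δ : ℝ} (hδ : 0 < δ) : ∀ᶠ p in cofinite, ε p < δ := by
  filter_upwards [hs.tendsto_cofinite_zero.eventually_lt_const (pow_pos hδ N)] with p hp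
  exact lt_of_pow_lt_pow_left₀ N hδ.le hp

/-- If an open set is filled up by disjoint open balls, but not contained in their union, then it
contains one of the closed balls. -/
theorem exists_closedBall_subset (hN : 2 ≤ N) (hΩ : IsOpen Ω) (hΩfin : volume Ω ≠ ⊤)
    (hε : ∀ p, 0 < ε p)
    (hdisj : Pairwise fun p q => Disjoint (ball (y p) (ε p)) (ball (y q) (ε q)))
    (hcover : Ω =ᵐ[volume] ⋃ p, ball (y p) (ε p)) (hproper : ¬ Ω ⊆ ⋃ p, ball (y p) (ε p)) :
    ∃ p, closedBall (y p) (ε p) ⊆ Ω := by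
  obtain ⟨x, hxΩ, hx⟩ := not_subset.1 hproper
  obtain ⟨R, hR, hRΩ⟩ := Metric.isOpen_iff.1 hΩ x hxΩ
  set S : Set ℕ := {p | (ball (y p) (ε p) ∩ ball x (R / 2)).Nonempty}
  -- With finitely many balls the union of their closures is closed, so the uncovered part of the
  -- ball of radius R/2 is open and null, hence empty.
  have hSinf : S.Infinite := by
    intro hfin
    refine hx (mem_iUnion.2 (mem_iUnion_ball_of_mem_nhds hN hfin hε hdisj ?_))
    refine mem_of_superset (ball_mem_nhds x (half_pos hR)) ?_
    have hclosed : IsClosed (⋃ p ∈ S, closedBall (y p) (ε p)) :=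
      hfin.isClosed_biUnion fun _ _ => isClosed_closedBall
    rw [← sdiff_eq_empty, ← (isOpen_ball.sdiff hclosed).measure_eq_zero_iff volume]
    refine measure_mono_null ?_ (ae_le_set.1 hcover.le)
    rintro z ⟨hz, hz'⟩
    refine ⟨hRΩ (ball_subset_ball (half_le_self hR.le) hz), fun hmem => ?_⟩
    obtain ⟨p, hp⟩ := mem_iUnion.1 hmem
    exact hz' (mem_iUnion₂.2 ⟨p, ⟨z, hp, hz⟩, ball_subset_closedBall hp⟩)
  have hsum := summable_pow_of_disjoint_balls hΩfin hε hdisj hcover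
  -- A ball of radius below R/8 meeting the ball of radius R/2 about x stays within R/2 + R/4 of x.
  have hev := eventually_cofinite_lt_of_summable_pow hsum (by positivity : 0 < R / 8)
  obtain ⟨p, hpS, hp⟩ := ((frequently_cofinite_iff_infinite.2 hSinf).and_eventually hev).exists
  obtain ⟨z, hz1, hz2⟩ := hpS
  refine ⟨p, fun w hw => hRΩ ?_⟩
  rw [mem_ball] at hz1 hz2 ⊢
  rw [mem_closedBall] at hw
  have h1 := dist_triangle w (y p) x
  have h2 := dist_triangle_left (y p) x z
  linarith

end Geometry

/-! ### Rescaling integrals, norms and test functions -/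

section Scaling

variable {N : ℕ} {𝕜 : Type*} [RCLike 𝕜]

theorem indicator_ball_smul_add {W : Type*} [Zero W] (k : EuclideanSpace ℝ (Fin N) → W) {r : ℝ}
    (hr : 0 < r) (c z : EuclideanSpace ℝ (Fin N)) :
    (ball c r).indicator k (r • z + c) = (ball 0 1).indicator (fun z => k (r • z + c)) z := by
  have : r • z + c ∈ ball c r ↔ z ∈ ball (0 : EuclideanSpace ℝ (Fin N)) 1 := by
    rw [mem_ball, dist_eq_norm, add_sub_cancel_right, norm_smul, Real.norm_of_nonneg hr.le,
      mem_ball_zero_iff]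
    exact mul_lt_iff_lt_one_right hr
  by_cases hz : z ∈ ball (0 : EuclideanSpace ℝ (Fin N)) 1
  · rw [indicator_of_mem hz, indicator_of_mem (this.2 hz)]
  · rw [indicator_of_notMem hz, indicator_of_notMem fun h => hz (this.1 h)]

theorem setIntegral_ball_eq {W : Type*} [NormedAddCommGroup W] [NormedSpace ℝ W]
    (k : EuclideanSpace ℝ (Fin N) → W) {r : ℝ} (hr : 0 < r) (c : EuclideanSpace ℝ (Fin N)) :
    ∫ x in ball c r, k x = r ^ N • ∫ z in ball 0 1, k (r • z + c) := by
  rw [← integral_indicator measurableSet_ball, ← integral_indicator measurableSet_ball]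
  simp only [← indicator_ball_smul_add k hr c]
  rw [← (measurableEmbedding_smul_add hr.ne' c).integral_map, map_smul_add_addHaar volume hr.ne',
    integral_smul_measure, finrank_euclideanSpace, Fintype.card_fin,
    ENNReal.toReal_ofReal (abs_nonneg _), abs_of_pos (by positivity), smul_smul,
    mul_inv_cancel₀ (by positivity), one_smul]

theorem setLIntegral_ball_eq (k : EuclideanSpace ℝ (Fin N) → ENNReal) {r : ℝ} (hr : 0 < r)
    (c : EuclideanSpace ℝ (Fin N)) :
    ∫⁻ x in ball c r, k x = ENNReal.ofReal (r ^ N) * ∫⁻ z in ball 0 1, k (r • z + c) := by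
  rw [← lintegral_indicator measurableSet_ball, ← lintegral_indicator measurableSet_ball]
  simp only [← indicator_ball_smul_add k hr c]
  rw [lintegral_comp_smul_add volume hr.ne', finrank_euclideanSpace, Fintype.card_fin,
    abs_of_pos (by positivity), ← mul_assoc, ← ENNReal.ofReal_mul (by positivity),
    mul_inv_cancel₀ (by positivity), ENNReal.ofReal_one, one_mul]

theorem aestronglyMeasurable_comp_inv_smul_sub {W : Type*} [TopologicalSpace W]
    {k : EuclideanSpace ℝ (Fin N) → W} {r : ℝ} (hr : 0 < r) (c : EuclideanSpace ℝ (Fin N))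
    (hk : AEStronglyMeasurable k (volume.restrict (ball 0 1))) :
    AEStronglyMeasurable (fun x => k (r⁻¹ • (x - c))) (volume.restrict (ball c r)) := by
  have h1 := (quasiMeasurePreserving_smul_add (volume : Measure (EuclideanSpace ℝ (Fin N)))
    (inv_ne_zero hr.ne') (-(r⁻¹ • c))).restrict (s := ball c r) (t := ball 0 1) fun x hx => by
      rw [mem_ball, dist_eq_norm] at hx
      simp only [mem_ball_zero_iff]
      rw [← sub_eq_add_neg, ← smul_sub, norm_smul, norm_inv,
        Real.norm_of_nonneg hr.le, inv_mul_lt_one₀ hr]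
      exact hx
  refine (hk.comp_quasiMeasurePreserving h1).congr (ae_of_all _ fun x => ?_)
  simp only [Function.comp, ← sub_eq_add_neg, ← smul_sub]

theorem eLpNorm_ball_comp_inv_smul_sub_sq {W : Type*} [NormedAddCommGroup W]
    (k : EuclideanSpace ℝ (Fin N) → W) {r : ℝ} (hr : 0 < r) (c : EuclideanSpace ℝ (Fin N)) :
    eLpNorm (fun x => k (r⁻¹ • (x - c))) 2 (volume.restrict (ball c r)) ^ 2 =
      ENNReal.ofReal (r ^ N) * eLpNorm k 2 (volume.restrict (ball 0 1)) ^ 2 := by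
  rw [eLpNorm_two_sq, eLpNorm_two_sq, setLIntegral_ball_eq _ hr]
  simp [inv_smul_smul₀ hr.ne']

theorem memLp_comp_inv_smul_sub {W : Type*} [NormedAddCommGroup W]
    {k : EuclideanSpace ℝ (Fin N) → W} {r : ℝ} (hr : 0 < r) (c : EuclideanSpace ℝ (Fin N))
    (hk : MemLp k 2 (volume.restrict (ball 0 1))) :
    MemLp (fun x => k (r⁻¹ • (x - c))) 2 (volume.restrict (ball c r)) := by
  refine ⟨aestronglyMeasurable_comp_inv_smul_sub hr c hk.1, ?_⟩
  refine ((ENNReal.pow_lt_top_iff (n := 2)).1 ?_).resolve_right two_ne_zero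
  rw [eLpNorm_ball_comp_inv_smul_sub_sq k hr c]
  exact ENNReal.mul_lt_top ENNReal.ofReal_lt_top (ENNReal.pow_lt_top hk.2)

theorem IsTestFunction.contDiff_one {U : Set (EuclideanSpace ℝ (Fin N))}
    {φ : EuclideanSpace ℝ (Fin N) → 𝕜} (hφ : IsTestFunction U φ) : ContDiff ℝ 1 φ :=
  hφ.1.of_le (by exact_mod_cast le_top)

theorem IsTestFunction.mono {U V : Set (EuclideanSpace ℝ (Fin N))}
    {φ : EuclideanSpace ℝ (Fin N) → 𝕜} (hφ : IsTestFunction U φ) (h : U ⊆ V) :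
    IsTestFunction V φ :=
  ⟨hφ.1, hφ.2.1, hφ.2.2.trans h⟩

theorem IsTestFunction.memLp {U : Set (EuclideanSpace ℝ (Fin N))}
    {φ : EuclideanSpace ℝ (Fin N) → 𝕜} (hφ : IsTestFunction U φ)
    (μ : Measure (EuclideanSpace ℝ (Fin N))) [IsFiniteMeasureOnCompacts μ] : MemLp φ 2 μ :=
  hφ.1.continuous.memLp_of_hasCompactSupport hφ.2.1

theorem IsTestFunction.memLp_partialDeriv {U : Set (EuclideanSpace ℝ (Fin N))}
    {φ : EuclideanSpace ℝ (Fin N) → 𝕜} (hφ : IsTestFunction U φ) (i : Fin N)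
    (μ : Measure (EuclideanSpace ℝ (Fin N))) [IsFiniteMeasureOnCompacts μ] :
    MemLp (partialDeriv i φ) 2 μ :=
  (hφ.contDiff_one.continuous_partialDeriv i).memLp_of_hasCompactSupport (hφ.2.1.fderiv_apply ℝ _)

theorem IsTestFunction.integrable_pairing {U V : Set (EuclideanSpace ℝ (Fin N))}
    {φ : EuclideanSpace ℝ (Fin N) → ℝ} (hφ : IsTestFunction U φ) (i : Fin N)
    {f g : EuclideanSpace ℝ (Fin N) → 𝕜} (hf : MemLp f 2 (volume.restrict V))
    (hg : MemLp g 2 (volume.restrict V)) :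
    IntegrableOn (fun x => partialDeriv i φ x • f x + φ x • g x) V :=
  (MemLp.integrable_smul_two (hφ.memLp_partialDeriv i _) hf).add
    (MemLp.integrable_smul_two (hφ.memLp _) hg)

theorem IsTestFunction.integral_pairing_eq_zero_iff {U V : Set (EuclideanSpace ℝ (Fin N))}
    {φ : EuclideanSpace ℝ (Fin N) → ℝ} (hφ : IsTestFunction U φ) (i : Fin N)
    {f g : EuclideanSpace ℝ (Fin N) → 𝕜} (hf : MemLp f 2 (volume.restrict V))
    (hg : MemLp g 2 (volume.restrict V)) :
    ∫ x in V, (partialDeriv i φ x • f x + φ x • g x) = 0 ↔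
      ∫ x in V, partialDeriv i φ x • f x = - ∫ x in V, φ x • g x := by
  rw [integral_add (MemLp.integrable_smul_two (hφ.memLp_partialDeriv i _) hf)
    (MemLp.integrable_smul_two (hφ.memLp _) hg), add_eq_zero_iff_eq_neg]

theorem partialDeriv_comp_smul_add {φ : EuclideanSpace ℝ (Fin N) → 𝕜} (hφ : ContDiff ℝ 1 φ)
    (r : ℝ) (c : EuclideanSpace ℝ (Fin N)) (i : Fin N) (z : EuclideanSpace ℝ (Fin N)) :
    partialDeriv i (fun z => φ (r • z + c)) z = r • partialDeriv i φ (r • z + c) := by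
  have h1 : HasFDerivAt (fun z : EuclideanSpace ℝ (Fin N) => r • z + c)
      (r • ContinuousLinearMap.id ℝ (EuclideanSpace ℝ (Fin N))) z :=
    ((hasFDerivAt_id z).const_smul r).add_const c
  have h2 := ((hφ.differentiable one_ne_zero (r • z + c)).hasFDerivAt.comp z h1).fderiv
  rw [Function.comp_def] at h2
  simp only [partialDeriv, h2]
  simp

theorem isTestFunction_comp_smul_add {U : Set (EuclideanSpace ℝ (Fin N))}
    {φ : EuclideanSpace ℝ (Fin N) → 𝕜} (hφ : IsTestFunction U φ) {r : ℝ} (hr : r ≠ 0)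
    (c : EuclideanSpace ℝ (Fin N)) :
    IsTestFunction ((fun z => r • z + c) ⁻¹' U) fun z => φ (r • z + c) := by
  refine ⟨hφ.1.comp ((contDiff_const_smul r).add contDiff_const), ?_, ?_⟩
  · exact hφ.2.1.comp_homeomorph ((Homeomorph.smulOfNeZero r hr).trans (Homeomorph.addRight c))
  · exact (tsupport_comp_subset_preimage φ (by fun_prop)).trans (preimage_mono hφ.2.2)

/-- The boundary functional of a rescaled function. -/
theorem integral_pairing_ball_eq {r : ℝ} (hr : 0 < r) (c : EuclideanSpace ℝ (Fin N))
    {f g F : EuclideanSpace ℝ (Fin N) → 𝕜}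
    (hF : ∀ᵐ x ∂(volume.restrict (ball c r)), F x = r • f (r⁻¹ • (x - c)))
    {H : EuclideanSpace ℝ (Fin N) → 𝕜}
    (hH : ∀ᵐ x ∂(volume.restrict (ball c r)), H x = g (r⁻¹ • (x - c)))
    {φ : EuclideanSpace ℝ (Fin N) → ℝ} (hφ : ContDiff ℝ 1 φ) (i : Fin N) :
    ∫ x in ball c r, (partialDeriv i φ x • F x + φ x • H x) =
      r ^ N • boundaryFunctional i f g fun z => φ (r • z + c) := by
  calc _ = ∫ x in ball c r, (partialDeriv i φ x • (r • f (r⁻¹ • (x - c)))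
          + φ x • g (r⁻¹ • (x - c))) := by
        refine integral_congr_ae ?_
        filter_upwards [hF, hH] with x h1 h2
        rw [h1, h2]
    _ = _ := by
        rw [setIntegral_ball_eq _ hr, boundaryFunctional]
        congr 2 with z
        -- The factor r in F is the one that the chain rule for φ produces, so both terms scale by
        -- r^N alone.
        rw [partialDeriv_comp_smul_add hφ, add_sub_cancel_right, inv_smul_smul₀ hr.ne', smul_smul,
          smul_eq_mul, mul_comm]

end Scaling

/-! ### Weak derivatives of F on a single ball -/

section Restriction

variable {N : ℕ} {𝕜 : Type*} [RCLike 𝕜] {Ω : Set (EuclideanSpace ℝ (Fin N))}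
  {y : ℕ → EuclideanSpace ℝ (Fin N)} {ε : ℕ → ℝ} {f F : EuclideanSpace ℝ (Fin N) → 𝕜}
  {G H : Fin N → EuclideanSpace ℝ (Fin N) → 𝕜}

/-- The weak derivatives of the rescaled copy of `f` on a ball are rescaled copies of the weak
derivatives of `f`. -/
theorem HasH1Gradient.ae_eq_comp_inv_smul_sub (hΩ : IsOpen Ω) {r : ℝ} (hr : 0 < r)
    {c : EuclideanSpace ℝ (Fin N)} (hc : ball c r ≤ᵐ[volume] Ω)
    (hG : HasH1Gradient (ball 0 1) f G) (hH : HasH1Gradient Ω F H)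
    (hF : ∀ᵐ x ∂(volume.restrict (ball c r)), F x = r • f (r⁻¹ • (x - c))) (i : Fin N) :
    ∀ᵐ x ∂(volume.restrict (ball c r)), H i x = G i (r⁻¹ • (x - c)) := by
  set g : EuclideanSpace ℝ (Fin N) → 𝕜 := fun x => G i (r⁻¹ • (x - c))
  have hg : MemLp g 2 (volume.restrict (ball c r)) := memLp_comp_inv_smul_sub hr c (hG.memLp_grad i)
  have hac : volume.restrict (ball c r) ≤ volume.restrict Ω := Measure.restrict_mono_ae hc
  have hHb : MemLp (H i) 2 (volume.restrict (ball c r)) := (hH.memLp_grad i).mono_measure hac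
  have hFb : MemLp F 2 (volume.restrict (ball c r)) := hH.memLp.mono_measure hac
  -- The ball lies in Ω only up to a null set, so test functions are supported in the open
  -- intersection, where both weak identities apply; the rest of the ball is null.
  have hU : IsOpen (Ω ∩ ball c r) := hΩ.inter isOpen_ball
  have hloc : LocallyIntegrableOn (fun x => H i x - g x) (Ω ∩ ball c r) volume := by
    have : IsFiniteMeasure ((volume : Measure (EuclideanSpace ℝ (Fin N))).restrict (ball c r)) :=
      ⟨by simpa using measure_ball_lt_top⟩
    have h1 : IntegrableOn (fun x => H i x - g x) (ball c r) :=
      memLp_one_iff_integrable.1 ((hHb.sub hg).mono_exponent one_le_two)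
    exact (h1.mono_set inter_subset_right).locallyIntegrableOn
  have key := hU.ae_eq_zero_of_integral_contDiff_smul_eq_zero hloc fun φ hφ1 hφ2 hφ3 => by
    have hφ : IsTestFunction (Ω ∩ ball c r) φ := ⟨hφ1, hφ2, hφ3⟩
    have hz : ∀ x ∉ Ω ∩ ball c r, φ x = 0 := fun x hx =>
      image_eq_zero_of_notMem_tsupport fun h => hx (hφ3 h)
    have hz' : ∀ x ∉ Ω ∩ ball c r, partialDeriv i φ x = 0 := fun x hx => by
      rw [partialDeriv, image_eq_zero_of_notMem_tsupport fun h =>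
        hx (hφ3 (tsupport_fderiv_subset ℝ h))]
      simp
    have h1 : ∫ x in ball c r, (partialDeriv i φ x • F x + φ x • H i x) = 0 := by
      have h2 := ((hφ.mono inter_subset_left).integral_pairing_eq_zero_iff i hH.memLp
        (hH.memLp_grad i)).2 (hH.integral_eq i φ (hφ.mono inter_subset_left))
      rw [← h2, setIntegral_eq_integral_of_forall_compl_eq_zero,
        setIntegral_eq_integral_of_forall_compl_eq_zero]
      · intro x hx
        simp [hz x fun h => hx h.1, hz' x fun h => hx h.1]
      · intro x hx
        simp [hz x fun h => hx h.2, hz' x fun h => hx h.2]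
    have h3 : ∫ x in ball c r, (partialDeriv i φ x • F x + φ x • g x) = 0 := by
      rw [integral_pairing_ball_eq hr c hF (ae_of_all _ fun x => rfl) hφ.contDiff_one i]
      have hφ' : IsTestFunction (ball 0 1) fun z => φ (r • z + c) := by
        refine (isTestFunction_comp_smul_add hφ hr.ne' c).mono fun z hz => ?_
        have := hz.2
        rw [mem_ball, dist_eq_norm, add_sub_cancel_right, norm_smul, Real.norm_of_nonneg hr.le]
          at this
        rw [mem_ball_zero_iff]
        exact (mul_lt_iff_lt_one_right hr).1 this
      rw [boundaryFunctional, (hφ'.integral_pairing_eq_zero_iff i hG.memLp (hG.memLp_grad i)).2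
        (hG.integral_eq i _ hφ'), smul_zero]
    rw [← setIntegral_eq_integral_of_forall_compl_eq_zero (s := ball c r)
      fun x hx => by simp [hz x fun h => hx h.2]]
    rw [← sub_eq_zero.2 (h1.trans h3.symm), ← integral_sub (hφ.integrable_pairing i hFb hHb)
      (hφ.integrable_pairing i hFb hg)]
    congr 1 with x
    rw [add_sub_add_left_eq_sub, smul_sub]
  rw [ae_restrict_iff' measurableSet_ball]
  filter_upwards [key, hc] with x h1 h2 hx
  exact sub_eq_zero.1 (h1 ⟨h2 hx, hx⟩)

end Restriction

/-! ### Summation over the balls and isolation of one term -/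

section Packing

variable {N : ℕ} {𝕜 : Type*} [RCLike 𝕜] {Ω : Set (EuclideanSpace ℝ (Fin N))}
  {y : ℕ → EuclideanSpace ℝ (Fin N)} {ε : ℕ → ℝ} {f F : EuclideanSpace ℝ (Fin N) → 𝕜}
  {G H : Fin N → EuclideanSpace ℝ (Fin N) → 𝕜}

/-- Countable additivity over the disjoint balls, each integral being rescaled to the unit ball. It
turns the weak derivative identity on Ω into the vanishing of a series. -/
theorem IsTestFunction.hasSum_boundaryFunctional (hε : ∀ p, 0 < ε p)
    (hdisj : Pairwise fun p q => Disjoint (ball (y p) (ε p)) (ball (y q) (ε q)))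
    (hcover : Ω =ᵐ[volume] ⋃ p, ball (y p) (ε p)) {U : Set (EuclideanSpace ℝ (Fin N))}
    {φ : EuclideanSpace ℝ (Fin N) → ℝ} (hφ : IsTestFunction U φ) (i : Fin N)
    (hFL : MemLp F 2 (volume.restrict Ω)) (hHL : MemLp (H i) 2 (volume.restrict Ω))
    (hF : ∀ p, ∀ᵐ x ∂(volume.restrict (ball (y p) (ε p))),
      F x = ε p • f ((ε p)⁻¹ • (x - y p)))
    (hH : ∀ p, ∀ᵐ x ∂(volume.restrict (ball (y p) (ε p))), H i x = G i ((ε p)⁻¹ • (x - y p))) :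
    HasSum (fun p => ε p ^ N • boundaryFunctional i f (G i) fun z => φ (ε p • z + y p))
      (∫ x in Ω, (partialDeriv i φ x • F x + φ x • H i x)) := by
  have hint := hφ.integrable_pairing i hFL hHL
  rw [IntegrableOn, Measure.restrict_congr_set hcover] at hint
  rw [Measure.restrict_congr_set hcover]
  refine (hasSum_integral_iUnion (fun p => measurableSet_ball) hdisj hint).congr_fun fun p => ?_
  exact (integral_pairing_ball_eq (hε p) (y p) (hF p) (hH p) hφ.contDiff_one i).symm

theorem tendsto_eLpNorm_two_zero_of_bound {α W : Type*} [MeasurableSpace α] {μ : Measure α}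
    [IsFiniteMeasure μ] [NormedAddCommGroup W] {u : ℕ → α → W} {C : ℝ}
    (hm : ∀ n, AEStronglyMeasurable (u n) μ) (hC : ∀ n x, ‖u n x‖ ≤ C)
    (h : ∀ᵐ x ∂μ, ∀ᶠ n in atTop, u n x = 0) :
    Tendsto (fun n => eLpNorm (u n) 2 μ) atTop (𝓝 0) := by
  have key : Tendsto (fun n => ∫⁻ x, ‖u n x‖ₑ ^ 2 ∂μ) atTop (𝓝 (∫⁻ _, 0 ∂μ)) := by
    refine tendsto_lintegral_of_dominated_convergence' (fun _ => ENNReal.ofReal C ^ 2)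
      (fun n => (hm n).enorm.pow_const 2) (fun n => ae_of_all _ fun x => ?_) ?_ ?_
    · simp only [← ofReal_norm]
      gcongr
      exact hC n x
    · rw [lintegral_const]
      exact ENNReal.mul_ne_top (by simp) (measure_ne_top _ _)
    · filter_upwards [h] with x hx
      refine tendsto_const_nhds.congr' ?_
      filter_upwards [hx] with n hn
      simp [hn]
  simp only [lintegral_zero, ← eLpNorm_two_sq] at key
  have := ((ENNReal.continuous_rpow_const (y := 1 / 2)).tendsto 0).comp key
  rw [ENNReal.zero_rpow_of_pos (by norm_num)] at this
  refine this.congr fun p => ?_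
  simp only [Function.comp]
  rw [← ENNReal.rpow_natCast, ← ENNReal.rpow_mul]
  norm_num

/-- If `∑ q, a q • T n q = 0` for all `n`, where `T n` is bounded and tends to `c` at `p` and to
zero elsewhere, then `c = 0`. -/
theorem eq_zero_of_tsum_smul_eq_zero {W : Type*} [NormedAddCommGroup W] [NormedSpace ℝ W]
    [CompleteSpace W] {a : ℕ → ℝ} (ha : ∀ q, 0 ≤ a q) (hsum : Summable a) {T : ℕ → ℕ → W} {K : ℝ}
    (hbound : ∀ n q, ‖T n q‖ ≤ K) {p : ℕ} {c : W} (hself : ∀ n, T n p = c)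
    (hlim : ∀ q ≠ p, Tendsto (fun n => T n q) atTop (𝓝 0)) (hp : a p ≠ 0)
    (hzero : ∀ n, ∑' q, a q • T n q = 0) : c = 0 := by
  have htsum : Tendsto (fun n => ∑' q, a q • T n q) atTop
      (𝓝 (∑' q, if q = p then a p • c else 0)) := by
    refine tendsto_tsum_of_dominated_convergence (bound := fun q => a q * K)
      (hsum.mul_right _) (fun q => ?_) (Eventually.of_forall fun n q => ?_)
    · split_ifs with h
      · subst h
        simp only [hself]
        exact tendsto_const_nhds
      · simpa using (hlim q h).const_smul (a q)
    · rw [norm_smul, Real.norm_of_nonneg (ha q)]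
      exact mul_le_mul_of_nonneg_left (hbound n q) (ha q)
  simp only [hzero, tsum_ite_eq] at htsum
  have := tendsto_nhds_unique htsum tendsto_const_nhds
  exact (smul_eq_zero.1 this).resolve_left hp

theorem tendsto_zero_of_enorm_le {W : Type*} [NormedAddCommGroup W] {w : ℕ → W}
    {b : ℕ → ENNReal} (hb : Tendsto b atTop (𝓝 0)) (h : ∀ n, ‖w n‖ₑ ≤ b n) :
    Tendsto w atTop (𝓝 0) := by
  rw [tendsto_zero_iff_norm_tendsto_zero]
  have h1 := tendsto_of_tendsto_of_tendsto_of_le_of_le tendsto_const_nhds hb (fun _ => zero_le) h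
  have h2 := (ENNReal.tendsto_toReal ENNReal.zero_ne_top).comp h1
  simpa [Function.comp_def] using h2

/-- If the boundary functionals of the rescaled copies of `f` cancel inside `Ω`, then the boundary
functional of `f` vanishes. -/
theorem boundaryFunctional_eq_zero_of_tsum_eq_zero (hN : 2 ≤ N) (hΩ : IsOpen Ω)
    (hε : ∀ p, 0 < ε p)
    (hdisj : Pairwise fun p q => Disjoint (ball (y p) (ε p)) (ball (y q) (ε q)))
    (hsum : Summable fun p => ε p ^ N) {p : ℕ} (hp : closedBall (y p) (ε p) ⊆ Ω)
    (hG : HasH1Gradient (ball 0 1) f G) (i : Fin N)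
    (hzero : ∀ φ : EuclideanSpace ℝ (Fin N) → ℝ, IsTestFunction Ω φ →
      ∑' q, ε q ^ N • boundaryFunctional i f (G i) (fun z => φ (ε q • z + y q)) = 0)
    {ψ : EuclideanSpace ℝ (Fin N) → ℝ} (hψ : IsTestFunction univ ψ) :
    boundaryFunctional i f (G i) ψ = 0 := by
  have : NeZero N := ⟨by omega⟩
  set σ := (volume : Measure (EuclideanSpace ℝ (Fin N))).toSphere
  obtain ⟨u, hu, hu1, hu2⟩ := hG.exists_contDiff_tendsto
  obtain ⟨M, hM, hbd⟩ := exists_enorm_boundaryFunctional_le hu hG.memLp hG.memLp_grad hu1 hu2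
  obtain ⟨C, hC⟩ := hψ.2.1.exists_bound_of_continuous hψ.1.continuous
  -- The compact closed ball has a margin δ inside Ω, so all the cutoffs below are supported in Ω.
  obtain ⟨δ, hδ, hδΩ⟩ := (isCompact_closedBall (y p) (ε p)).exists_cthickening_subset_open hΩ hp
  rw [cthickening_closedBall hδ.le (hε p).le] at hδΩ
  set d : ℕ → ℝ := fun n => δ * ((n : ℝ) + 2)⁻¹
  have hd : ∀ n, 0 < d n := fun n => by positivity
  have hdδ : ∀ n, d n ≤ δ := fun n =>
    mul_le_of_le_one_right hδ.le (inv_le_one_of_one_le₀ (by linarith [n.cast_nonneg (α := ℝ)]))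
  have hd0 : Tendsto d atTop (𝓝 0) := by simpa using tendsto_inv_natCast_add_two.const_mul δ
  let χ : ℕ → ContDiffBump (y p) := fun n => ⟨ε p, ε p + d n, hε p, by linarith [hd n]⟩
  set φ : ℕ → EuclideanSpace ℝ (Fin N) → ℝ := fun n x => ψ ((ε p)⁻¹ • (x - y p)) * χ n x
  have hφ : ∀ n, IsTestFunction Ω (φ n) := by
    intro n
    have hsupp : tsupport (φ n) ⊆ closedBall (y p) (ε p + d n) := by
      rw [← (χ n).tsupport_eq]
      exact tsupport_mul_subset_right
    have haff : ContDiff ℝ ∞ fun x : EuclideanSpace ℝ (Fin N) => (ε p)⁻¹ • (x - y p) := by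
      fun_prop
    refine ⟨(hψ.1.comp haff).mul (χ n).contDiff,
      (isCompact_closedBall _ _).of_isClosed_subset (isClosed_tsupport _) hsupp,
      hsupp.trans ((closedBall_subset_closedBall ?_).trans hδΩ)⟩
    linarith [hdδ n]
  have hφC : ∀ n x, ‖φ n x‖ ≤ C := by
    intro n x
    rw [norm_mul, Real.norm_of_nonneg (χ n).nonneg]
    exact (mul_le_of_le_one_right (norm_nonneg _) (χ n).le_one).trans (hC _)
  have hφ1 : ∀ n q, ContDiff ℝ 1 fun z => φ n (ε q • z + y q) := fun n q =>
    (isTestFunction_comp_smul_add (hφ n) (hε q).ne' (y q)).contDiff_one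
  have hφm : ∀ n q, Continuous fun z : sphere (0 : EuclideanSpace ℝ (Fin N)) 1 =>
      φ n (ε q • (z : EuclideanSpace ℝ (Fin N)) + y q) := fun n q =>
    (hφ1 n q).continuous.comp continuous_subtype_val
  -- The cutoff is 1 on the whole ball p, so the transplanted φ n is ψ there, together with its
  -- derivative because the ball is open.
  have hself : ∀ n, boundaryFunctional i f (G i) (fun z => φ n (ε p • z + y p)) =
      boundaryFunctional i f (G i) ψ := by
    intro n
    have hEq : EqOn (fun z => φ n (ε p • z + y p)) ψ (ball 0 1) := by
      intro z hz
      have hz1 : ‖z‖ < 1 := by simpa using hz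
      have : ε p • z + y p ∈ closedBall (y p) (χ n).rIn := by
        rw [mem_closedBall, dist_eq_norm, add_sub_cancel_right, norm_smul,
          Real.norm_of_nonneg (hε p).le]
        exact mul_le_of_le_one_right (hε p).le hz1.le
      simp only [φ, (χ n).one_of_mem_closedBall this, add_sub_cancel_right,
        inv_smul_smul₀ (hε p).ne', mul_one]
    refine setIntegral_congr_fun measurableSet_ball fun z hz => ?_
    have h1 := hEq hz
    have h2 := (hEq.eventuallyEq_of_mem (isOpen_ball.mem_nhds hz)).fderiv_eq (𝕜 := ℝ)
    simp only at h1
    simp only [partialDeriv, h1, h2]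
  -- Uniform in n and q: |φ n| ≤ C everywhere and the sphere has finite measure.
  set K : ENNReal := σ univ ^ (2 : ENNReal).toReal⁻¹ * ENNReal.ofReal C * M
  have hK : K ≠ ⊤ := ENNReal.mul_ne_top (ENNReal.mul_ne_top
    (ENNReal.rpow_ne_top_of_nonneg (by positivity) (measure_ne_top _ _)) ENNReal.ofReal_ne_top) hM
  have hbound : ∀ n q, ‖boundaryFunctional i f (G i) (fun z => φ n (ε q • z + y q))‖ ≤ K.toReal := by
    intro n q
    rw [← toReal_enorm]
    refine ENNReal.toReal_mono hK ((hbd i _ (hφ1 n q)).trans ?_)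
    exact mul_le_mul' (eLpNorm_le_of_ae_bound (ae_of_all _ fun z => hφC n _)) le_rfl
  have hlim : ∀ q ≠ p, Tendsto (fun n => boundaryFunctional i f (G i)
      (fun z => φ n (ε q • z + y q))) atTop (𝓝 0) := by
    intro q hq
    have h0 : Tendsto (fun n => eLpNorm (fun z : sphere (0 : EuclideanSpace ℝ (Fin N)) 1 =>
        φ n (ε q • (z : EuclideanSpace ℝ (Fin N)) + y q)) 2 σ * M) atTop (𝓝 0) := by
      -- The excluded direction is the only possible point of contact with the closed ball p. Every
      -- other point of sphere q has positive distance from that ball, so φ n eventually vanishes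
      -- there.
      have hae : ∀ᵐ z : sphere (0 : EuclideanSpace ℝ (Fin N)) 1 ∂σ,
          (z : EuclideanSpace ℝ (Fin N)) ≠ ‖y p - y q‖⁻¹ • (y p - y q) := by
        rw [ae_iff]
        simp only [not_not]
        by_cases hw : ‖y p - y q‖⁻¹ • (y p - y q) ∈ sphere (0 : EuclideanSpace ℝ (Fin N)) 1
        · refine measure_mono_null (fun z hz => ?_) (toSphere_singleton hN ⟨_, hw⟩)
          exact Subtype.ext hz
        · convert measure_empty (μ := σ)
          refine eq_empty_iff_forall_notMem.2 fun z hz => hw ?_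
          rw [← show (z : EuclideanSpace ℝ (Fin N)) = _ from hz]
          exact z.2
      have := tendsto_eLpNorm_two_zero_of_bound (μ := σ)
        (fun n => (hφm n q).aestronglyMeasurable) (fun n z => hφC n _) (by
          filter_upwards [hae] with z hz
          have hout : ε q • (z : EuclideanSpace ℝ (Fin N)) + y q ∉ closedBall (y p) (ε p) :=
            fun h => hz (eq_of_mem_closedBall_of_disjoint (hε q) (hε p) (hdisj hq) (by simp) h)
          rw [mem_closedBall, not_le] at hout
          filter_upwards [hd0.eventually_le_const (sub_pos.2 hout)] with n hn
          have : χ n (ε q • (z : EuclideanSpace ℝ (Fin N)) + y q) = 0 :=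
            (χ n).zero_of_le_dist (by
              change ε p + d n ≤ _
              linarith)
          simp only [φ, this, mul_zero])
      have h := ENNReal.Tendsto.mul_const (b := M) this (Or.inr hM)
      rwa [zero_mul] at h
    exact tendsto_zero_of_enorm_le h0 fun n => hbd i _ (hφ1 n q)
  exact eq_zero_of_tsum_smul_eq_zero (fun q => (pow_pos (hε q) N).le) hsum hbound hself hlim
    (pow_pos (hε p) N).ne' fun n => hzero _ (hφ n)

/-- Any weak gradient of F must restrict to the rescaled G on each ball, so the defining identity on
Ω is the vanishing of the series, from which one term can be isolated. -/
theorem HasH1Gradient.boundaryFunctional_eq_zero_of_memH1 (hN : 2 ≤ N) (hΩ : IsOpen Ω)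
    (hΩfin : volume Ω ≠ ⊤) (hε : ∀ p, 0 < ε p)
    (hdisj : Pairwise fun p q => Disjoint (ball (y p) (ε p)) (ball (y q) (ε q)))
    (hcover : Ω =ᵐ[volume] ⋃ p, ball (y p) (ε p)) (hproper : ¬ Ω ⊆ ⋃ p, ball (y p) (ε p))
    (hG : HasH1Gradient (ball 0 1) f G)
    (hF : ∀ p, ∀ᵐ x ∂(volume.restrict (ball (y p) (ε p))),
      F x = ε p • f ((ε p)⁻¹ • (x - y p))) (hF1 : MemH1 Ω F) (i : Fin N)
    {ψ : EuclideanSpace ℝ (Fin N) → ℝ} (hψ : IsTestFunction univ ψ) :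
    boundaryFunctional i f (G i) ψ = 0 := by
  obtain ⟨H, hH⟩ := hF1
  obtain ⟨p, hp⟩ := exists_closedBall_subset hN hΩ hΩfin hε hdisj hcover hproper
  have hsub : ∀ q, ball (y q) (ε q) ≤ᵐ[volume] Ω := fun q =>
    ((subset_iUnion (fun p => ball (y p) (ε p)) q).eventuallyLE).trans hcover.symm.le
  refine boundaryFunctional_eq_zero_of_tsum_eq_zero hN hΩ hε hdisj
    (summable_pow_of_disjoint_balls hΩfin hε hdisj hcover) hp hG i (fun φ hφ => ?_) hψ
  rw [(hφ.hasSum_boundaryFunctional hε hdisj hcover i hH.memLp (hH.memLp_grad i) hF fun q =>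
    hG.ae_eq_comp_inv_smul_sub hΩ (hε q) (hsub q) hH (hF q) i).tsum_eq]
  exact (hφ.integral_pairing_eq_zero_iff i hH.memLp (hH.memLp_grad i)).2 (hH.integral_eq i φ hφ)

/-- A function on disjoint balls, whose `L²` norms squared on the balls are dominated by the volumes,
is square integrable. -/
theorem memLp_iUnion_ball (hε : ∀ p, 0 < ε p)
    (hdisj : Pairwise fun p q => Disjoint (ball (y p) (ε p)) (ball (y q) (ε q)))
    (hsum : Summable fun p => ε p ^ N) {h : EuclideanSpace ℝ (Fin N) → 𝕜}
    (hm : ∀ p, AEStronglyMeasurable h (volume.restrict (ball (y p) (ε p)))) {C : ENNReal}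
    (hC : C ≠ ⊤) (hle : ∀ p, eLpNorm h 2 (volume.restrict (ball (y p) (ε p))) ^ 2 ≤
      ENNReal.ofReal (ε p ^ N) * C) :
    MemLp h 2 (volume.restrict (⋃ p, ball (y p) (ε p))) := by
  refine ⟨aestronglyMeasurable_iUnion_iff.2 hm, ?_⟩
  refine ((ENNReal.pow_lt_top_iff (n := 2)).1 ?_).resolve_right two_ne_zero
  rw [eLpNorm_two_sq, lintegral_iUnion (fun p => measurableSet_ball) hdisj]
  calc _ ≤ ∑' p, ENNReal.ofReal (ε p ^ N) * C := ENNReal.tsum_le_tsum fun p => by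
        rw [← eLpNorm_two_sq]; exact hle p
    _ < ⊤ := by
        rw [ENNReal.tsum_mul_right, ← ENNReal.ofReal_tsum_of_nonneg
          (fun p => pow_nonneg (hε p).le N) hsum]
        exact ENNReal.mul_lt_top ENNReal.ofReal_lt_top hC.lt_top

/-- A test function on Ω, rescaled from any ball, is a test function on the whole space, so each
term of the series is zero. It need not vanish on the boundaries of the balls, hence the assumption
for all ψ. -/
theorem HasH1Gradient.memH1_of_boundaryFunctional_eq_zero [NeZero N]
    (hΩfin : volume Ω ≠ ⊤) (hε : ∀ p, 0 < ε p)
    (hdisj : Pairwise fun p q => Disjoint (ball (y p) (ε p)) (ball (y q) (ε q)))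
    (hcover : Ω =ᵐ[volume] ⋃ p, ball (y p) (ε p))
    (hG : HasH1Gradient (ball 0 1) f G)
    (hF : ∀ p, ∀ᵐ x ∂(volume.restrict (ball (y p) (ε p))),
      F x = ε p • f ((ε p)⁻¹ • (x - y p)))
    (hzero : ∀ i, ∀ ψ : EuclideanSpace ℝ (Fin N) → ℝ, IsTestFunction univ ψ →
      boundaryFunctional i f (G i) ψ = 0) : MemH1 Ω F := by
  have hsum := summable_pow_of_disjoint_balls hΩfin hε hdisj hcover
  -- The factor ε p in F requires bounded radii for F to be square integrable; either ε p ≤ 1 or ε p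
  -- ≤ ε p ^ N.
  obtain ⟨R, hR⟩ : ∃ R, ∀ p, ε p ≤ R := by
    have hlim : Tendsto (fun p => ε p ^ N) atTop (𝓝 0) := hsum.tendsto_atTop_zero
    obtain ⟨R, hR⟩ := hlim.bddAbove_range
    refine ⟨1 + R, fun p => ?_⟩
    have h1 : ε p ^ N ≤ R := hR (mem_range_self p)
    rcases le_total (ε p) 1 with h | h
    · linarith [pow_nonneg (hε p).le N]
    · linarith [le_self_pow₀ h (NeZero.ne N)]
  -- At each point at most one summand is nonzero, the balls being disjoint.
  set H : Fin N → EuclideanSpace ℝ (Fin N) → 𝕜 := fun i x =>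
    ∑' p, (ball (y p) (ε p)).indicator (fun x => G i ((ε p)⁻¹ • (x - y p))) x
  have hHb : ∀ i p, ∀ x ∈ ball (y p) (ε p), H i x = G i ((ε p)⁻¹ • (x - y p)) := by
    intro i p x hx
    simp only [H]
    rw [tsum_eq_single p, indicator_of_mem hx]
    intro q hq
    exact indicator_of_notMem (fun h => (disjoint_left.1 (hdisj hq) h hx)) _
  have hHae : ∀ i p, ∀ᵐ x ∂(volume.restrict (ball (y p) (ε p))),
      H i x = G i ((ε p)⁻¹ • (x - y p)) := fun i p =>
    (ae_restrict_mem measurableSet_ball).mono fun x hx => hHb i p x hx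
  have hFL : MemLp F 2 (volume.restrict Ω) := by
    rw [Measure.restrict_congr_set hcover]
    refine memLp_iUnion_ball hε hdisj hsum (fun p => ?_) (C := ENNReal.ofReal R ^ 2 *
      eLpNorm f 2 (volume.restrict (ball 0 1)) ^ 2) ?_ fun p => ?_
    · exact ((aestronglyMeasurable_comp_inv_smul_sub (hε p) (y p) hG.memLp.1).const_smul
        (ε p)).congr ((hF p).mono fun x hx => hx.symm)
    · exact ENNReal.mul_ne_top (by simp) (ENNReal.pow_ne_top hG.memLp.eLpNorm_ne_top)
    · rw [eLpNorm_congr_ae (hF p)]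
      have := eLpNorm_const_smul (ε p) (fun x => f ((ε p)⁻¹ • (x - y p))) 2
        (volume.restrict (ball (y p) (ε p)))
      rw [show (fun x => ε p • f ((ε p)⁻¹ • (x - y p))) =
        ε p • fun x => f ((ε p)⁻¹ • (x - y p)) from rfl, this, mul_pow,
        eLpNorm_ball_comp_inv_smul_sub_sq _ (hε p), mul_left_comm]
      gcongr
      rw [← ofReal_norm, Real.norm_of_nonneg (hε p).le]
      exact ENNReal.ofReal_le_ofReal (hR p)
  have hHL : ∀ i, MemLp (H i) 2 (volume.restrict Ω) := by
    intro i
    rw [Measure.restrict_congr_set hcover]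
    refine memLp_iUnion_ball hε hdisj hsum (fun p => ?_)
      (C := eLpNorm (G i) 2 (volume.restrict (ball 0 1)) ^ 2) ?_ fun p => ?_
    · exact (aestronglyMeasurable_comp_inv_smul_sub (hε p) (y p) (hG.memLp_grad i).1).congr
        ((hHae i p).mono fun x hx => hx.symm)
    · exact ENNReal.pow_ne_top (hG.memLp_grad i).eLpNorm_ne_top
    · rw [eLpNorm_congr_ae (hHae i p), eLpNorm_ball_comp_inv_smul_sub_sq _ (hε p)]
  refine ⟨H, hFL, hHL, fun i φ hφ => ?_⟩
  rw [← hφ.integral_pairing_eq_zero_iff i hFL (hHL i)]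
  refine (hφ.hasSum_boundaryFunctional hε hdisj hcover i hFL (hHL i) hF (hHae i)).unique ?_
  simp only [hzero i _ ((isTestFunction_comp_smul_add hφ (hε _).ne' _).mono (subset_univ _)),
    smul_zero]
  exact hasSum_zero

end Packing
-- The equivalences assembled
theorem mainTheorem9 {𝕜 : Type*} [RCLike 𝕜] (N : ℕ) (hN : 2 ≤ N)
    (Ω : Set (EuclideanSpace ℝ (Fin N))) (hΩ : IsOpen Ω) (hΩfin : volume Ω ≠ ⊤)
    (y : ℕ → EuclideanSpace ℝ (Fin N)) (ε : ℕ → ℝ) (hε : ∀ p, 0 < ε p)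
    (hdisj : Pairwise fun p q => Disjoint (ball (y p) (ε p)) (ball (y q) (ε q)))
    (hcover : Ω =ᵐ[volume] ⋃ p, ball (y p) (ε p))
    (hproper : ¬ Ω ⊆ ⋃ p, ball (y p) (ε p))
    (f : EuclideanSpace ℝ (Fin N) → 𝕜) (hf : MemH1 (ball 0 1) f)
    (F : EuclideanSpace ℝ (Fin N) → 𝕜)
    (hF : ∀ p, ∀ᵐ x ∂(volume.restrict (ball (y p) (ε p))),
      F x = ε p • f ((ε p)⁻¹ • (x - y p))) :
    (MemH1 Ω F ↔ HasTrace f 0) ∧ (HasTrace f 0 ↔ MemH10 (ball 0 1) f) := by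
  have : NeZero N := ⟨by omega⟩
  have h10 : ∀ G, HasH1Gradient (ball 0 1) f G →
      (∀ i, ∀ ψ : EuclideanSpace ℝ (Fin N) → ℝ, IsTestFunction univ ψ →
        boundaryFunctional i f (G i) ψ = 0) → MemH10 (ball 0 1) f := fun G hG hzero =>
    hG.memH10_of_integral_eq fun i ψ hψ =>
      hG.integral_eq_of_boundaryFunctional_eq_zero hψ.contDiff_one (hzero i ψ hψ)
  refine ⟨⟨fun hF1 => ?_, fun hT => ?_⟩, ⟨fun hT => ?_, fun h => h.hasTrace_zero⟩⟩
  -- Zero trace is reached through H¹₀, whose test functions supply an approximating sequence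
  -- vanishing on the sphere.
  · obtain ⟨G, hG⟩ := hf
    exact (h10 G hG fun i ψ hψ => hG.boundaryFunctional_eq_zero_of_memH1 hN hΩ hΩfin hε hdisj
      hcover hproper hF hF1 i hψ).hasTrace_zero
  · obtain ⟨G, hG, hzero⟩ := hT.exists_boundaryFunctional_eq_zero
    exact hG.memH1_of_boundaryFunctional_eq_zero hΩfin hε hdisj hcover hF hzero
  · obtain ⟨G, hG, hzero⟩ := hT.exists_boundaryFunctional_eq_zero
    exact h10 G hG hzero
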